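/- Let $a,b,c$ be a basis of $\mathfrak{sl}_2(\mathbb R)$ (the real trace-zero $2\times2$ matrices) with $[b,a]=c$, $[a,c]=2a$, $[b,c]=-2b$; for instance $a=\begin{pmatrix}0&0\\1&0\end{pmatrix}$, $b=\begin{pmatrix}0&1\\0&0\end{pmatrix}$, $c=\begin{pmatrix}1&0\\0&-1\end{pmatrix}$. Let $p:G\to SL_2(\mathbb R)$ be a connected covering space, with its structure of Lie group for which $p$ is a homomorphism; the Lie algebra of $G$ is identified with $\mathfrak{sl}_2(\mathbb R)$ by the differential of $p$, and $e^X\in G$ denotes the exponential of $X\in\mathfrak{sl}_2(\mathbb R)$. Consider on $G$ the left-invariant control system $$\dot q(t)=q(t)\,\bigl(a+u_0(t)\,b\bigr),\qquad q(0)=\mathrm{id}_G,$$ with piecewise constant controls $u_0:[0,\tau]\to\mathbb R$; write $q(u_0,\tau)$ for its solution at time $\tau$. Let $\mathcal A_{st}\subset G$ be the set of small-time reachable elements, i.e. of those $g\in G$ such that for every $T>0$ there are $\tau\in[0,T]$ and a piecewise constant control $u_0$ on $[0,\tau]$ with $q(u_0,\tau)=g$. An element of $G$ is small-time approximately reachable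 if it lies in the closure $\overline{\mathcal A_{st}}$, an element $X\in\mathfrak{sl}_2(\mathbb R)$ is a good Lie bracket if $e^{vX}\in\overline{\mathcal A_{st}}$ for every $v\in\mathbb R$, and the system is small-time controllable if $\mathcal A_{st}=G$. Then: 1. $b$ and $c$ are good Lie brackets; 2. $e^{t(a-b)}$ is small-time approximately reachable for every $t\ge0$; 3. the system is small-time controllable on $G$ if and only if $G$ is not the universal covering space of $SL_2(\mathbb R)$ (i.e. $G$ is not simply connected). -/

import Mathlib

open Set Topology
open scoped unitInterval MatrixGroups

/-- The Lie algebra `sl₂(ℝ)` of real `2 × 2` matrices of trace zero. -/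
abbrev SL2Alg : Type := LieAlgebra.SpecialLinear.sl (Fin 2) ℝ

theorem SL2Alg.det_exp (X : SL2Alg) :
    (NormedSpace.exp (X : Matrix (Fin 2) (Fin 2) ℝ)).det = 1 := by
  obtain ⟨M, hM⟩ := X
  have htr : M.trace = 0 := by
    simpa [LieAlgebra.SpecialLinear.sl] using hM
  have h11 : M 1 1 = -M 0 0 := by
    rw [Matrix.trace_fin_two] at htr; linarith
  set J : Matrix (Fin 2) (Fin 2) ℝ := !![0, 1; -1, 0] with hJ
  have hJinv : J⁻¹ = !![0, -1; 1, 0] := by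
    apply Matrix.inv_eq_right_inv
    ext i j; fin_cases i <;> fin_cases j <;> simp [hJ, Matrix.mul_apply, Fin.sum_univ_two]
  have hJu : IsUnit J := by
    rw [Matrix.isUnit_iff_isUnit_det]; simp [hJ, Matrix.det_fin_two]
  have hadj : ∀ A : Matrix (Fin 2) (Fin 2) ℝ, J * A.transpose * J⁻¹ = A.adjugate := by
    intro A
    rw [hJinv, Matrix.adjugate_fin_two]
    ext i j; fin_cases i <;> fin_cases j <;>
      simp [hJ, Matrix.mul_apply, Matrix.vecMul, dotProduct, Fin.sum_univ_two]
  have hneg : M.adjugate = -M := by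
    rw [Matrix.adjugate_fin_two]
    ext i j; fin_cases i <;> fin_cases j <;> simp [h11]
  have key : NormedSpace.exp (-M) = (NormedSpace.exp M).adjugate := by
    rw [← hneg, ← hadj, Matrix.exp_conj J _ hJu, Matrix.exp_transpose, hadj]
  have h1 : NormedSpace.exp M * NormedSpace.exp (-M) = 1 := by
    rw [← Matrix.exp_add_of_commute _ _ (Commute.refl M).neg_right, add_neg_cancel,
      NormedSpace.exp_zero]
  rw [key, Matrix.mul_adjugate] at h1
  simpa using congrFun (congrFun h1 0) 0

/-- The matrix exponential `sl₂(ℝ) → SL₂(ℝ)`. -/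
noncomputable def SL2Alg.exp (X : SL2Alg) : SL(2, ℝ) :=
  ⟨NormedSpace.exp (X : Matrix (Fin 2) (Fin 2) ℝ), X.det_exp⟩

theorem SL2Alg.continuous_exp_smul (X : SL2Alg) :
    Continuous fun t : ℝ => SL2Alg.exp (t • X) := by
  refine Continuous.subtype_mk ?_ _
  open scoped Matrix.Norms.Operator in
  exact NormedSpace.exp_continuous.comp (continuous_id.smul continuous_const)

theorem SL2Alg.exp_zero : SL2Alg.exp 0 = 1 := by
  apply Subtype.ext
  simp [SL2Alg.exp]

/-- The path `t ↦ e^{tX}`, `0 ≤ t ≤ 1`, in `SL₂(ℝ)`. -/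
noncomputable def SL2Alg.expPath (X : SL2Alg) : C(I, SL(2, ℝ)) :=
  ⟨fun t => SL2Alg.exp ((t : ℝ) • X), X.continuous_exp_smul.comp continuous_subtype_val⟩

section Covering

theorem SL2Alg.expPath_zero {G : Type*} [Group G] (p : G →* SL(2, ℝ)) (X : SL2Alg) : X.expPath 0 = p 1 := by
  simp [SL2Alg.expPath, SL2Alg.exp_zero]

variable {G : Type*} [Group G] [TopologicalSpace G]

/-- The exponential map `sl₂(ℝ) → G` of a covering group `p : G → SL₂(ℝ)`, whose Lie algebra is
identified with `sl₂(ℝ)` through the differential of `p`: `e^X` is the endpoint of the lift,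
starting at the identity of `G`, of the path `t ↦ e^{tX}` of `SL₂(ℝ)`, `0 ≤ t ≤ 1`. -/
noncomputable def coverExp {p : G →* SL(2, ℝ)} (hp : IsCoveringMap p) (X : SL2Alg) : G :=
  hp.liftPath X.expPath 1 (SL2Alg.expPath_zero p X) 1

/-- `u` is piecewise constant on `[0, τ]`: it is constant on each of the intervals cut out by
finitely many points. -/
def IsPiecewiseConstant (τ : ℝ) (u : ℝ → ℝ) : Prop :=
  ∃ s : Finset ℝ, ∀ x ∈ Icc 0 τ, ∀ y ∈ Icc 0 τ, x ≤ y → Disjoint (Icc x y) (s : Set ℝ) → u x = u y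

/-- `q` is the solution on `[0, τ]`, starting at the identity, of the left-invariant system
`q' = q (a + u b)` on the covering group `p : G → SL₂(ℝ)` for the piecewise constant control `u`.
As `p` is a local diffeomorphism and a homomorphism, this means that `q` is continuous and that
its projection to `SL₂(ℝ)` satisfies the matrix equation `Q' = Q (a + u b)`
at all but finitely many times. -/
def IsSolution (p : G →* SL(2, ℝ)) (a b : SL2Alg) (τ : ℝ) (u : ℝ → ℝ) (q : ℝ → G) : Prop :=
  ContinuousOn q (Icc 0 τ) ∧ q 0 = 1 ∧
    ∃ s : Finset ℝ, ∀ t ∈ Ioo 0 τ, t ∉ s →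
      HasDerivAt (fun r => (p (q r) : Matrix (Fin 2) (Fin 2) ℝ))
        ((p (q t) : Matrix (Fin 2) (Fin 2) ℝ) * (a + u t • b : SL2Alg)) t

/-- The set `𝒜_st` of small-time reachable elements of the system `q' = q (a + u b)` on `G`. -/
def smallTimeReachable (p : G →* SL(2, ℝ)) (a b : SL2Alg) : Set G :=
  {g | ∀ T > 0, ∃ τ ∈ Icc (0 : ℝ) T, ∃ (u : ℝ → ℝ) (q : ℝ → G),
    IsPiecewiseConstant τ u ∧ IsSolution p a b τ u q ∧ q τ = g}

/-- `g` lies in the closure of the set of small-time reachable elements. -/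
def IsSmallTimeApproxReachable (p : G →* SL(2, ℝ)) (a b : SL2Alg) (g : G) : Prop :=
  g ∈ closure (smallTimeReachable p a b)

/-- `X` is a good Lie bracket for `q' = q (a + u b)` on `G`. -/
def IsGoodLieBracket {p : G →* SL(2, ℝ)} (hp : IsCoveringMap p) (a b X : SL2Alg) : Prop :=
  ∀ v : ℝ, IsSmallTimeApproxReachable p a b (coverExp hp (v • X))

/-- Every element of `G` is small-time reachable. -/
def IsSmallTimeControllable (p : G →* SL(2, ℝ)) (a b : SL2Alg) : Prop :=
  smallTimeReachable p a b = univ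

end Covering

/-!
The idea is to lift the Iwasawa decomposition of `SL₂(ℝ)` to `G`.

Every triple with the given brackets is conjugate, by a real invertible matrix, to the standard one
(`SL2Alg.exists_conj_std`), and conjugation changes neither the exponential map of `G` nor the
reachable sets. For the standard triple, write an element of `SL₂(ℝ)` as
`R(θ) diag(e^s, e^{-s}) (1 v; 0 1)`; its first column, seen as a complex number, is `e^{s + iθ}`.
The product of the corresponding exponentials in `G` is a map `iwasawaLift : ℂ × ℝ → G` with
coordinates `(s + iθ, v)`. It has the path lifting property, because the complex exponential is a
covering of `ℂ \ {0}`; it is open, and it is surjective because `G` is connected.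

*Elements with `θ > 0` are small-time reachable.* First consider limits of elements reachable in
small time; they form a semigroup. It contains `e^{vb}` (large constant controls), then
`e^{sc}`, since `(1 x; 0 1) (1 0; ε 1) (1 y; 0 1)` tends to `diag(e^s, e^{-s})` for
`x = (e^s - 1)/ε` and `y = (e^{-s} - 1)/ε`, and then `e^{φ(a - b)}` for `φ ≥ 0`, which is conjugate
by a diagonal element to the flow of the control `-ε⁻²` during the time `εφ`. So it contains all
elements with `θ ≥ 0` (`iwasawaLift_mem_limitReachable`). Limits in the interior of this set are
reached exactly (`mem_smallTimeReachable_of_mem_nhds`), because the sets reachable within time `T`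
have interior points arbitrarily close to the identity: the controls `0, 1, 0` during three
independent times already produce an open set. The first two assertions follow by letting `θ`
decrease to its limit.

*Controllability.* Along a solution the first column `z` satisfies `Im (z'/z) = |z|⁻² > 0`, so `θ`
does not decrease (`IsSolution.exists_iwasawaLift_eq`). If `G` is simply connected, `θ` is a
well-defined function on `G` (`fst_eq_of_iwasawaLift_eq`, by homotopy lifting along the complex
exponential), and elements with `θ < 0` cannot be reached. If `G` is not simply connected, then
`iwasawaLift` is not injective, hence some rotation `R(θ)` with `θ > 0` is trivial in `G`
(`exists_coverExp_rotation_eq_one`); adding full periods makes the angle of every element positive.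
-/

/-! ### The exponential map of a covering group of `SL₂(ℝ)` -/

open scoped Matrix.Norms.Operator in
theorem SL2Alg.continuous_exp_smul_add_smul (X Y : SL2Alg) :
    Continuous fun x : ℝ × ℝ => SL2Alg.exp (x.1 • X + x.2 • Y) := by
  refine Continuous.subtype_mk ?_ _
  exact NormedSpace.exp_continuous.comp
    ((continuous_fst.smul continuous_const).add (continuous_snd.smul continuous_const))

section CoverExp

variable {G : Type*} [Group G] [TopologicalSpace G] {p : G →* SL(2, ℝ)} (hp : IsCoveringMap p)

theorem eq_of_proj_eq_of_apply_zero_eq (hp : IsCoveringMap p) {f g : ℝ → G}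
    (hf : Continuous f) (hg : Continuous g)
    (h : ∀ t, p (f t) = p (g t)) (h0 : f 0 = g 0) (t : ℝ) : f t = g t :=
  congrFun (hp.eq_of_comp_eq hf hg (funext h) 0 h0) t

/-- A continuous lift to `G` of the one-parameter subgroup `t ↦ exp (tX)` computes `coverExp`. -/
theorem eq_coverExp_of_proj {X : SL2Alg} {f : ℝ → G} (hf : Continuous f) (h0 : f 0 = 1)
    (h : ∀ t, p (f t) = SL2Alg.exp (t • X)) : f 1 = coverExp hp X := by
  have := (hp.eq_liftPath_iff (γ := X.expPath) (e := 1) (SL2Alg.expPath_zero p X)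
    (Γ := fun t : I => f t)).2
    ⟨hf.comp continuous_subtype_val, funext fun t => h t, by simpa using h0⟩
  exact congrFun this 1

/-- The lift of the map `(x, y) ↦ exp (xX + yY)` from the simply connected plane. -/
theorem exists_lift_exp (X Y : SL2Alg) : ∃ F : C(ℝ × ℝ, G), F 0 = 1 ∧
    (∀ x, p (F x) = SL2Alg.exp (x.1 • X + x.2 • Y)) ∧
    ∀ x, F x = coverExp hp (x.1 • X + x.2 • Y) := by
  obtain ⟨F, ⟨F0, hF⟩, -⟩ := hp.existsUnique_continuousMap_lifts
    ⟨_, SL2Alg.continuous_exp_smul_add_smul X Y⟩ (0 : ℝ × ℝ) (1 : G)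
    (by simp [SL2Alg.exp_zero])
  have hF' : ∀ x, p (F x) = SL2Alg.exp (x.1 • X + x.2 • Y) := fun x => congrFun hF x
  refine ⟨F, F0, hF', fun x => ?_⟩
  have := eq_coverExp_of_proj hp (X := x.1 • X + x.2 • Y) (f := fun t : ℝ => F (t • x))
    (by fun_prop) (by simpa using F0) (fun t => by
      rw [hF']; congr 1; simp [mul_smul])
  simpa using this

theorem continuous_coverExp_smul_add_smul (X Y : SL2Alg) :
    Continuous fun x : ℝ × ℝ => coverExp hp (x.1 • X + x.2 • Y) := by
  obtain ⟨F, -, -, hF⟩ := exists_lift_exp hp X Y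
  exact F.continuous.congr hF

theorem continuous_coverExp_smul (X : SL2Alg) : Continuous fun t : ℝ => coverExp hp (t • X) := by
  have := (continuous_coverExp_smul_add_smul hp X 0).comp
    (continuous_id.prodMk (continuous_const (y := (0 : ℝ))))
  simpa [Function.comp_def] using this

@[simp] theorem proj_coverExp (X : SL2Alg) : p (coverExp hp X) = SL2Alg.exp X := by
  obtain ⟨F, -, h1, h2⟩ := exists_lift_exp hp X 0
  have := h1 (1, 0)
  rw [h2] at this
  simpa using this

@[simp] theorem coverExp_zero : coverExp hp 0 = 1 := by
  obtain ⟨F, h0, -, h2⟩ := exists_lift_exp hp 0 0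
  simpa [h0] using (h2 0).symm

theorem SL2Alg.exp_add_smul (X : SL2Alg) (s t : ℝ) :
    SL2Alg.exp ((s + t) • X) = SL2Alg.exp (s • X) * SL2Alg.exp (t • X) := by
  apply Subtype.ext
  have : ((s + t) • X : SL2Alg).1 = s • X.1 + t • X.1 := by
    rw [← add_smul]; rfl
  simp only [SL2Alg.exp, this]
  rw [Matrix.exp_add_of_commute]
  · rfl
  · exact ((Commute.refl X.1).smul_left s).smul_right t

theorem coverExp_add_smul [IsTopologicalGroup G] (X : SL2Alg) (s t : ℝ) :
    coverExp hp ((s + t) • X) = coverExp hp (s • X) * coverExp hp (t • X) := by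
  have hc := continuous_coverExp_smul hp X
  refine eq_of_proj_eq_of_apply_zero_eq hp (f := fun t => coverExp hp ((s + t) • X))
    (g := fun t => coverExp hp (s • X) * coverExp hp (t • X))
    (hc.comp (continuous_const.add continuous_id)) (continuous_const.mul hc) (fun r => ?_)
    (by simp) t
  simp [SL2Alg.exp_add_smul]

theorem coverExp_neg_smul [IsTopologicalGroup G] (X : SL2Alg) (t : ℝ) :
    coverExp hp ((-t) • X) = (coverExp hp (t • X))⁻¹ := by
  rw [eq_inv_iff_mul_eq_one, ← coverExp_add_smul]
  simp

end CoverExp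

/-! ### Reachable sets -/

section Reachable

variable {G : Type*} [Group G] [TopologicalSpace G]

/-- The elements reachable from the identity in some time `τ ∈ [0, T]`. -/
def reachableWithin (p : G →* SL(2, ℝ)) (a b : SL2Alg) (T : ℝ) : Set G :=
  {g | ∃ τ ∈ Icc (0 : ℝ) T, ∃ (u : ℝ → ℝ) (q : ℝ → G),
    IsPiecewiseConstant τ u ∧ IsSolution p a b τ u q ∧ q τ = g}

variable {p : G →* SL(2, ℝ)} {a b : SL2Alg}

theorem reachableWithin_mono {S T : ℝ} (h : S ≤ T) :
    reachableWithin p a b S ⊆ reachableWithin p a b T := by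
  rintro g ⟨τ, hτ, rest⟩
  exact ⟨τ, ⟨hτ.1, hτ.2.trans h⟩, rest⟩

open scoped Matrix.Norms.Operator in
theorem SL2Alg.hasDerivAt_exp_smul (X : SL2Alg) (t : ℝ) :
    HasDerivAt (fun r : ℝ => (SL2Alg.exp (r • X) : Matrix (Fin 2) (Fin 2) ℝ))
      ((SL2Alg.exp (t • X) : Matrix (Fin 2) (Fin 2) ℝ) * (X : Matrix (Fin 2) (Fin 2) ℝ)) t :=
  hasDerivAt_exp_smul_const (𝕂 := ℝ) (X : Matrix (Fin 2) (Fin 2) ℝ) t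

/-- A constant control `u` moves the identity along the one-parameter subgroup of `a + u b`. -/
theorem coverExp_mem_reachableWithin (hp : IsCoveringMap p) {t : ℝ} (ht : 0 ≤ t) (u : ℝ) :
    coverExp hp (t • (a + u • b)) ∈ reachableWithin p a b t := by
  refine ⟨t, ⟨ht, le_rfl⟩, fun _ => u, fun r => coverExp hp (r • (a + u • b)),
    ⟨∅, fun _ _ _ _ _ _ => rfl⟩, ⟨(continuous_coverExp_smul hp _).continuousOn, by simp, ∅, ?_⟩,
    rfl⟩
  intro r _ _
  simpa using SL2Alg.hasDerivAt_exp_smul (a + u • b) r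

open scoped Matrix.Norms.Elementwise in
theorem Matrix.hasDerivAt_iff_entries {f : ℝ → Matrix (Fin 2) (Fin 2) ℝ}
    {f' : Matrix (Fin 2) (Fin 2) ℝ} {t : ℝ} :
    HasDerivAt f f' t ↔ ∀ i j, HasDerivAt (fun r => f r i j) (f' i j) t := by
  refine (hasDerivAt_pi (φ := f)).trans (forall_congr' fun i => hasDerivAt_pi)

theorem IsPiecewiseConstant.concat {κ τ : ℝ} {u v : ℝ → ℝ} (hu : IsPiecewiseConstant κ u)
    (hv : IsPiecewiseConstant τ v) :
    IsPiecewiseConstant (κ + τ) fun t => if t < κ then u t else v (t - κ) := by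
  classical
  obtain ⟨s, hs⟩ := hu
  obtain ⟨r, hr⟩ := hv
  refine ⟨insert κ (s ∪ r.image (· + κ)), fun x hx y hy hxy hd => ?_⟩
  rw [disjoint_left] at hd
  have hsub : ∀ z ∈ Icc x y, z ≠ κ ∧ z ∉ s ∧ z - κ ∉ r := fun z hz => by
    have := hd hz
    simp only [Finset.coe_insert, Finset.coe_union, Finset.coe_image, mem_insert_iff, mem_union,
      Finset.mem_coe, mem_image, not_or, not_exists, not_and] at this
    exact ⟨this.1, this.2.1, fun h => this.2.2 _ h (by ring)⟩
  by_cases h : y < κ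
  · have hx' : x < κ := hxy.trans_lt h
    simp only [h, hx', if_true]
    exact hs x ⟨hx.1, hx'.le⟩ y ⟨hy.1, h.le⟩ hxy (disjoint_left.2 fun z hz => (hsub z hz).2.1)
  · have hx' : ¬ x < κ := fun hlt => (hsub κ ⟨hlt.le, not_lt.1 h⟩).1 rfl
    simp only [h, hx', if_false]
    refine hr _ ⟨by linarith, by linarith [hx.2]⟩ _ ⟨by linarith, by linarith [hy.2]⟩ (by linarith)
      (disjoint_left.2 fun z hz => ?_)
    simpa using (hsub (z + κ) ⟨by linarith [hz.1], by linarith [hz.2]⟩).2.2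

/-- By left invariance, the left translate of a solution continues another solution. -/
theorem IsSolution.concat [IsTopologicalGroup G] {κ τ : ℝ} {u v : ℝ → ℝ} {q r : ℝ → G}
    (hκ : 0 ≤ κ) (hτ : 0 ≤ τ)
    (hq : IsSolution p a b κ u q) (hr : IsSolution p a b τ v r) :
    IsSolution p a b (κ + τ) (fun t => if t < κ then u t else v (t - κ))
      fun t => if t ≤ κ then q t else q κ * r (t - κ) := by
  classical
  obtain ⟨hqc, hq0, s, hs⟩ := hq
  obtain ⟨hrc, hr0, s', hs'⟩ := hr
  refine ⟨?_, by simpa [hκ] using hq0, insert κ (s ∪ s'.image (· + κ)), fun t ht hts => ?_⟩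
  · have h1 : ContinuousOn (fun t => if t ≤ κ then q t else q κ * r (t - κ)) (Icc 0 κ) :=
      hqc.congr fun t ht => if_pos ht.2
    have h2 : ContinuousOn (fun t => if t ≤ κ then q t else q κ * r (t - κ))
        (Icc κ (κ + τ)) := by
      have : ContinuousOn (fun t => q κ * r (t - κ)) (Icc κ (κ + τ)) :=
        continuousOn_const.mul (hrc.comp (by fun_prop) fun t ht =>
          ⟨by linarith [ht.1], by linarith [ht.2]⟩)
      refine this.congr fun t ht => ?_
      rcases ht.1.eq_or_lt with rfl | h
      · simp [hr0]
      · simp [h.not_ge]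
    rw [← Icc_union_Icc_eq_Icc hκ (by linarith : κ ≤ κ + τ)]
    exact h1.union_of_isClosed h2 isClosed_Icc isClosed_Icc
  · simp only [Finset.mem_insert, Finset.mem_union, Finset.mem_image, not_or, not_exists,
      not_and] at hts
    obtain ⟨h1, h2, h3⟩ := hts
    rcases lt_or_gt_of_ne h1 with h | h
    · simp only [h, h.le, if_true]
      rw [Matrix.hasDerivAt_iff_entries]
      intro i j
      refine (Matrix.hasDerivAt_iff_entries.1 (hs t ⟨ht.1, h⟩ h2) i j).congr_of_eventuallyEq ?_
      filter_upwards [Iio_mem_nhds h] with x hx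
      rw [if_pos (le_of_lt hx)]
    · simp only [h.not_ge, h.not_gt, if_false]
      have hd := hs' (t - κ) ⟨by linarith, by linarith [ht.2]⟩ fun hm => h3 _ hm (by ring)
      rw [Matrix.hasDerivAt_iff_entries] at hd ⊢
      intro i j
      have hd2 := ((hd 0 j).comp_sub_const t κ).const_mul ((p (q κ)).1 i 0) |>.add
        (((hd 1 j).comp_sub_const t κ).const_mul ((p (q κ)).1 i 1))
      have he : ((p (q κ * r (t - κ))).1 * (a + v (t - κ) • b : SL2Alg).1) i j =
          (p (q κ)).1 i 0 * ((p (r (t - κ))).1 * (a + v (t - κ) • b : SL2Alg).1) 0 j +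
          (p (q κ)).1 i 1 * ((p (r (t - κ))).1 * (a + v (t - κ) • b : SL2Alg).1) 1 j := by
        rw [map_mul, Matrix.SpecialLinearGroup.coe_mul, Matrix.mul_assoc, Matrix.mul_apply,
          Fin.sum_univ_two]
      rw [he]
      refine hd2.congr_of_eventuallyEq ?_
      filter_upwards [Ioi_mem_nhds h] with x hx
      rw [if_neg (not_le.2 hx), map_mul, Matrix.SpecialLinearGroup.coe_mul, Matrix.mul_apply,
        Fin.sum_univ_two]
      rfl

theorem mul_mem_reachableWithin [IsTopologicalGroup G] {S T : ℝ} {g h : G}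
    (hg : g ∈ reachableWithin p a b S) (hh : h ∈ reachableWithin p a b T) :
    g * h ∈ reachableWithin p a b (S + T) := by
  obtain ⟨κ, hκ, u, q, hu, hq, rfl⟩ := hg
  obtain ⟨τ, hτ, v, r, hv, hr, rfl⟩ := hh
  refine ⟨κ + τ, ⟨add_nonneg hκ.1 hτ.1, add_le_add hκ.2 hτ.2⟩, _, _, hu.concat hv,
    hq.concat hκ.1 hτ.1 hr, ?_⟩
  split_ifs with h
  · obtain rfl : τ = 0 := by linarith [hτ.1]
    simp [hr.2.1]
  · simp

variable (p a b) in
/-- The elements that are, for every `T > 0`, limits of elements reachable within time `T`. -/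
def limitReachable : Set G := {g | ∀ T > 0, g ∈ closure (reachableWithin p a b T)}

theorem mul_mem_limitReachable [IsTopologicalGroup G] {g h : G}
    (hg : g ∈ limitReachable p a b) (hh : h ∈ limitReachable p a b) :
    g * h ∈ limitReachable p a b := by
  intro T hT
  have := map_mem_closure₂ (continuous_mul (M := G)) (hg (T / 2) (by linarith))
    (hh (T / 2) (by linarith)) fun x hx y hy => mul_mem_reachableWithin hx hy
  simpa using this

theorem one_mem_reachableWithin (hp : IsCoveringMap p) {T : ℝ} (hT : 0 ≤ T) :
    (1 : G) ∈ reachableWithin p a b T :=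
  reachableWithin_mono hT
    (by simpa using coverExp_mem_reachableWithin (a := a) (b := b) hp le_rfl 0)

theorem one_mem_limitReachable (hp : IsCoveringMap p) :
    (1 : G) ∈ limitReachable p a b :=
  fun _ hT => subset_closure (one_mem_reachableWithin hp hT.le)

/-- A limit, as `ε → 0+`, of products `c ε · d ε · e ε` with `c ε`, `e ε` limit-reachable and
`d ε` reachable within time `O(ε)`, is limit-reachable. -/
theorem mem_limitReachable_of_tendsto [IsTopologicalGroup G] {g : G} {c d e : ℝ → G} {K : ℝ}
    (hc : ∀ ε > 0, c ε ∈ limitReachable p a b)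
    (hd : ∀ ε > 0, d ε ∈ reachableWithin p a b (K * ε))
    (he : ∀ ε > 0, e ε ∈ limitReachable p a b)
    (h : Filter.Tendsto (fun ε => c ε * d ε * e ε) (𝓝[>] 0) (𝓝 g)) :
    g ∈ limitReachable p a b := by
  intro T hT
  refine isClosed_closure.mem_of_tendsto h ?_
  have h1 : ∀ᶠ ε in 𝓝[>] (0 : ℝ), K * ε < T / 3 := by
    refine Filter.Tendsto.eventually_lt_const (by linarith : 0 < T / 3) ?_
    have : Filter.Tendsto (fun ε : ℝ => K * ε) (𝓝 0) (𝓝 (K * 0)) :=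
      (continuous_const.mul continuous_id).tendsto 0
    rw [mul_zero] at this
    exact this.mono_left nhdsWithin_le_nhds
  filter_upwards [h1, self_mem_nhdsWithin] with ε hε hpos
  have hd' := subset_closure (reachableWithin_mono hε.le (hd ε hpos))
  have h12 := map_mem_closure₂ (continuous_mul (M := G)) (hc ε hpos (T / 3) (by linarith)) hd'
    fun x hx y hy => mul_mem_reachableWithin hx hy
  have h123 := map_mem_closure₂ (continuous_mul (M := G)) h12 (he ε hpos (T / 3) (by linarith))
    fun x hx y hy => mul_mem_reachableWithin hx hy
  convert h123 using 2
  ring_nf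

end Reachable

/-! ### Matrix exponentials in the standard triple -/

open scoped Matrix.Norms.Operator in
/-- Uniqueness for the linear equation `M' = M X`. -/
theorem SL2Alg.exp_smul_eq_of_hasDerivAt {X : SL2Alg} {M : ℝ → Matrix (Fin 2) (Fin 2) ℝ}
    (h0 : M 0 = 1) (h : ∀ t, HasDerivAt M (M t * X.1) t) (t : ℝ) :
    (SL2Alg.exp (t • X)).1 = M t := by
  have h1 : ∀ t : ℝ, HasDerivAt (fun r : ℝ => M r * NormedSpace.exp (r • (-X.1))) 0 t := by
    intro t
    have hM : HasDerivAt M (M t * X.1) t := h t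
    have hd := hM.mul (hasDerivAt_exp_smul_const' (𝕂 := ℝ) (-X.1) t)
    refine hd.congr_deriv ?_
    simp [mul_assoc]
  have h2 : M t * NormedSpace.exp (t • (-X.1)) = 1 := by
    have := is_const_of_deriv_eq_zero (fun t => (h1 t).differentiableAt)
      (fun t => (h1 t).deriv) t 0
    simpa [h0] using this
  have h3 : NormedSpace.exp (t • (-X.1)) * NormedSpace.exp (t • X.1) = 1 := by
    rw [← Matrix.exp_add_of_commute]
    · simp
    · exact ((Commute.refl X.1).neg_left.smul_left t).smul_right t
  calc (SL2Alg.exp (t • X)).1 = 1 * NormedSpace.exp (t • X.1) := (one_mul _).symm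
    _ = M t := by rw [← h2, mul_assoc, h3, mul_one]

/-- Conjugation by an invertible matrix `P` with inverse `P'` commutes with the exponential. -/
theorem SL2Alg.exp_conj {X Y : SL2Alg} {P P' : Matrix (Fin 2) (Fin 2) ℝ} (hP : P * P' = 1)
    (h : Y.1 = P * X.1 * P') : (SL2Alg.exp Y).1 = P * (SL2Alg.exp X).1 * P' := by
  have hinv : P⁻¹ = P' := Matrix.inv_eq_right_inv hP
  have hu : IsUnit P := IsUnit.of_mul_eq_one _ hP
  simp only [SL2Alg.exp, h]
  rw [← hinv, Matrix.exp_conj _ _ hu]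

theorem SL2Alg.mem_sl_of_trace {M : Matrix (Fin 2) (Fin 2) ℝ} (h : M.trace = 0) :
    M ∈ LieAlgebra.SpecialLinear.sl (Fin 2) ℝ := by
  simpa [LieAlgebra.SpecialLinear.sl] using h

theorem SL2Alg.trace_eq_zero (X : SL2Alg) : X.1.trace = 0 := by
  simpa [LieAlgebra.SpecialLinear.sl] using X.2

/-- The standard lower triangular nilpotent element. -/
def SL2Alg.stdA : SL2Alg := ⟨!![0, 0; 1, 0],
  SL2Alg.mem_sl_of_trace (by simp [Matrix.trace_fin_two])⟩

/-- The standard upper triangular nilpotent element. -/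
def SL2Alg.stdB : SL2Alg := ⟨!![0, 1; 0, 0],
  SL2Alg.mem_sl_of_trace (by simp [Matrix.trace_fin_two])⟩

/-- The standard diagonal element. -/
def SL2Alg.stdC : SL2Alg := ⟨!![1, 0; 0, -1],
  SL2Alg.mem_sl_of_trace (by simp [Matrix.trace_fin_two])⟩

open SL2Alg (stdA stdB stdC)

theorem SL2Alg.exp_smul_stdA (t : ℝ) : (SL2Alg.exp (t • stdA)).1 = !![1, 0; t, 1] := by
  refine SL2Alg.exp_smul_eq_of_hasDerivAt (M := fun t => !![1, 0; t, 1])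
    (by ext i j; fin_cases i <;> fin_cases j <;> simp) (fun t => ?_) t
  rw [Matrix.hasDerivAt_iff_entries]
  intro i j
  fin_cases i <;> fin_cases j <;> simp [stdA, hasDerivAt_id', hasDerivAt_const]

theorem SL2Alg.exp_smul_stdB (t : ℝ) : (SL2Alg.exp (t • stdB)).1 = !![1, t; 0, 1] := by
  refine SL2Alg.exp_smul_eq_of_hasDerivAt (M := fun t => !![1, t; 0, 1])
    (by ext i j; fin_cases i <;> fin_cases j <;> simp) (fun t => ?_) t
  rw [Matrix.hasDerivAt_iff_entries]
  intro i j
  fin_cases i <;> fin_cases j <;> simp [stdB, hasDerivAt_id', hasDerivAt_const]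

theorem SL2Alg.exp_smul_stdC (t : ℝ) :
    (SL2Alg.exp (t • stdC)).1 = !![Real.exp t, 0; 0, Real.exp (-t)] := by
  refine SL2Alg.exp_smul_eq_of_hasDerivAt (M := fun t => !![Real.exp t, 0; 0, Real.exp (-t)])
    (by ext i j; fin_cases i <;> fin_cases j <;> simp) (fun t => ?_) t
  rw [Matrix.hasDerivAt_iff_entries]
  intro i j
  fin_cases i <;> fin_cases j <;> simp [stdC, Real.hasDerivAt_exp, hasDerivAt_const]
  simpa using (hasDerivAt_neg t).exp

theorem SL2Alg.exp_smul_stdA_sub_stdB (t : ℝ) :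
    (SL2Alg.exp (t • (stdA - stdB))).1 =
      !![Real.cos t, -Real.sin t; Real.sin t, Real.cos t] := by
  refine SL2Alg.exp_smul_eq_of_hasDerivAt
    (M := fun t => !![Real.cos t, -Real.sin t; Real.sin t, Real.cos t])
    (by ext i j; fin_cases i <;> fin_cases j <;> simp) (fun t => ?_) t
  rw [Matrix.hasDerivAt_iff_entries]
  intro i j
  have := (Real.hasDerivAt_sin t).neg
  fin_cases i <;> fin_cases j <;>
    simp [stdA, stdB, Real.hasDerivAt_cos, Real.hasDerivAt_sin, Matrix.mul_apply,
      Fin.sum_univ_two]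
  exact this

theorem SL2Alg.exp_smul_stdA_add_stdB (t : ℝ) :
    (SL2Alg.exp (t • (stdA + (1 : ℝ) • stdB))).1 =
      !![Real.cosh t, Real.sinh t; Real.sinh t, Real.cosh t] := by
  refine SL2Alg.exp_smul_eq_of_hasDerivAt
    (M := fun t => !![Real.cosh t, Real.sinh t; Real.sinh t, Real.cosh t])
    (by ext i j; fin_cases i <;> fin_cases j <;> simp) (fun t => ?_) t
  rw [Matrix.hasDerivAt_iff_entries]
  intro i j
  fin_cases i <;> fin_cases j <;>
    simp [stdA, stdB, Real.hasDerivAt_cosh, Real.hasDerivAt_sinh, Matrix.mul_apply,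
      Fin.sum_univ_two]

/-! ### Iwasawa coordinates on `SL₂(ℝ)` -/

namespace SL2

/-- The first column of a matrix, as a complex number. -/
def column (Q : SL(2, ℝ)) : ℂ := ⟨Q.1 0 0, Q.1 1 0⟩

/-- The scalar product of the two columns, divided by the square norm of the first one. -/
noncomputable def shear (Q : SL(2, ℝ)) : ℝ :=
  (Q.1 0 0 * Q.1 0 1 + Q.1 1 0 * Q.1 1 1) / (Q.1 0 0 ^ 2 + Q.1 1 0 ^ 2)

theorem det_eq_one (Q : SL(2, ℝ)) : Q.1 0 0 * Q.1 1 1 - Q.1 0 1 * Q.1 1 0 = 1 := by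
  rw [← Matrix.det_fin_two]; exact Q.2

theorem sq_add_sq_pos (Q : SL(2, ℝ)) : 0 < Q.1 0 0 ^ 2 + Q.1 1 0 ^ 2 := by
  have := det_eq_one Q
  rcases eq_or_ne (Q.1 0 0) 0 with h | h
  · rcases eq_or_ne (Q.1 1 0) 0 with h' | h'
    · simp [h, h'] at this
    · positivity
  · positivity

theorem column_ne_zero (Q : SL(2, ℝ)) : column Q ≠ 0 := by
  intro h
  have h0 : Q.1 0 0 = 0 := congrArg Complex.re h
  have h1 : Q.1 1 0 = 0 := congrArg Complex.im h
  simpa [h0, h1] using sq_add_sq_pos Q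

theorem continuous_entry (i j : Fin 2) : Continuous fun Q : SL(2, ℝ) => Q.1 i j :=
  (continuous_subtype_val (p := fun A : Matrix (Fin 2) (Fin 2) ℝ => A.det = 1)).matrix_elem i j

theorem continuous_column : Continuous column := by
  have : column = fun Q => Complex.equivRealProdCLM.symm (Q.1 0 0, Q.1 1 0) := by
    ext Q; simp [column, Complex.ext_iff]
  rw [this]
  exact Complex.equivRealProdCLM.symm.continuous.comp
    ((continuous_entry 0 0).prodMk (continuous_entry 1 0))

theorem continuous_shear : Continuous shear := by
  have := continuous_entry
  exact Continuous.div (by fun_prop) (by fun_prop) fun Q => (sq_add_sq_pos Q).ne'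

theorem ext_of_column_shear {Q R : SL(2, ℝ)} (hc : column Q = column R) (hs : shear Q = shear R) :
    Q = R := by
  have h0 : Q.1 0 0 = R.1 0 0 := congrArg Complex.re hc
  have h1 : Q.1 1 0 = R.1 1 0 := congrArg Complex.im hc
  have hpos := sq_add_sq_pos R
  have dQ := det_eq_one Q
  have dR := det_eq_one R
  simp only [shear, h0, h1] at hs
  rw [div_left_inj' hpos.ne'] at hs
  rw [h0, h1] at dQ
  have e0 : Q.1 0 1 = R.1 0 1 := by
    apply mul_left_cancel₀ hpos.ne'
    linear_combination R.1 0 0 * hs - R.1 1 0 * dQ + R.1 1 0 * dR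
  have e1 : Q.1 1 1 = R.1 1 1 := by
    apply mul_left_cancel₀ hpos.ne'
    linear_combination R.1 1 0 * hs + R.1 0 0 * dQ - R.1 0 0 * dR
  apply Subtype.ext
  ext i j
  fin_cases i <;> fin_cases j <;> assumption

/-- The matrix `R(θ) diag(e^s, e^{-s}) (1 v; 0 1)` with Iwasawa coordinates `(s + iθ, v)`. -/
noncomputable def iwasawa (w : ℂ × ℝ) : SL(2, ℝ) :=
  SL2Alg.exp (w.1.im • (stdA - stdB)) * SL2Alg.exp (w.1.re • stdC) * SL2Alg.exp (w.2 • stdB)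

theorem iwasawa_val (w : ℂ × ℝ) : (iwasawa w).1 =
    !![Real.cos w.1.im, -Real.sin w.1.im; Real.sin w.1.im, Real.cos w.1.im] *
      !![Real.exp w.1.re, 0; 0, Real.exp (-w.1.re)] * !![1, w.2; 0, 1] := by
  rw [← SL2Alg.exp_smul_stdA_sub_stdB, ← SL2Alg.exp_smul_stdB, ← SL2Alg.exp_smul_stdC]
  rfl

theorem column_iwasawa (w : ℂ × ℝ) : column (iwasawa w) = Complex.exp w.1 := by
  apply Complex.ext
  · simp [column, iwasawa_val, Complex.exp_re, mul_comm]
  · simp [column, iwasawa_val, Complex.exp_im, mul_comm]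

theorem shear_iwasawa (w : ℂ × ℝ) : shear (iwasawa w) = w.2 := by
  have h := sq_add_sq_pos (iwasawa w)
  rw [shear, div_eq_iff h.ne']
  simp [iwasawa_val]
  ring

theorem iwasawa_eq_iff {w : ℂ × ℝ} {Q : SL(2, ℝ)} :
    iwasawa w = Q ↔ Complex.exp w.1 = column Q ∧ w.2 = shear Q := by
  constructor
  · rintro rfl
    exact ⟨(column_iwasawa w).symm, (shear_iwasawa w).symm⟩
  · rintro ⟨h1, h2⟩
    exact ext_of_column_shear ((column_iwasawa w).trans h1) ((shear_iwasawa w).trans h2)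

end SL2

/-! ### Iwasawa coordinates on a covering group -/

section IwasawaLift

open SL2Alg (stdA stdB stdC)

variable {G : Type*} [Group G] [TopologicalSpace G] {p : G →* SL(2, ℝ)}

/-- If `p ∘ f` has a continuous local section through `x₀`, then `f` is open at `x₀`. -/
theorem image_mem_nhds_of_section (hp : IsCoveringMap p) {X : Type*}
    [TopologicalSpace X] {f : X → G} {x₀ : X}
    (hf : ContinuousAt f x₀) {τ : SL(2, ℝ) → X} (hτ : ContinuousAt τ (p (f x₀)))
    (h0 : τ (p (f x₀)) = x₀) (h : ∀ᶠ Q in 𝓝 (p (f x₀)), p (f (τ Q)) = Q) {U : Set X}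
    (hU : U ∈ 𝓝 x₀) : f '' U ∈ 𝓝 (f x₀) := by
  obtain ⟨V, hVo, hV, hinj⟩ := hp.isLocalHomeomorph.isLocallyInjective (f x₀)
  have hpc : ContinuousAt p (f x₀) := hp.continuous.continuousAt
  have hτp : ContinuousAt (fun g => τ (p g)) (f x₀) := hτ.comp hpc
  have h1 : Filter.Tendsto (fun g => τ (p g)) (𝓝 (f x₀)) (𝓝 x₀) := by
    simpa [ContinuousAt, h0] using hτp
  have h2 : Filter.Tendsto (fun g => f (τ (p g))) (𝓝 (f x₀)) (𝓝 (f x₀)) := hf.tendsto.comp h1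
  filter_upwards [hVo.mem_nhds hV, h2 (hVo.mem_nhds hV), hpc.eventually h, h1 hU] with g h3 h4 h5 h6
  exact ⟨τ (p g), h6, hinj h4 h3 h5⟩

variable (hp : IsCoveringMap p)

/-- The lift of `SL2.iwasawa` to the covering group `G`. -/
noncomputable def iwasawaLift (w : ℂ × ℝ) : G :=
  coverExp hp (w.1.im • (stdA - stdB)) * coverExp hp (w.1.re • stdC) * coverExp hp (w.2 • stdB)

@[simp] theorem proj_iwasawaLift (w : ℂ × ℝ) : p (iwasawaLift hp w) = SL2.iwasawa w := by
  simp [iwasawaLift, SL2.iwasawa]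

@[simp] theorem iwasawaLift_zero : iwasawaLift hp 0 = 1 := by simp [iwasawaLift]

variable [IsTopologicalGroup G]

theorem continuous_iwasawaLift : Continuous (iwasawaLift hp) := by
  have h := continuous_coverExp_smul hp
  exact ((((h _).comp (Complex.continuous_im.comp continuous_fst)).mul
    ((h _).comp (Complex.continuous_re.comp continuous_fst))).mul ((h _).comp continuous_snd))

/-- Paths lift along the Iwasawa coordinates: the first column is a path in `ℂ \ {0}`, which lifts
along the complex exponential. -/
theorem exists_path_lift_iwasawaLift {γ : I → G} (hγ : Continuous γ) {w : ℂ × ℝ}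
    (h0 : γ 0 = iwasawaLift hp w) :
    ∃ δ : I → ℂ × ℝ, Continuous δ ∧ δ 0 = w ∧ ∀ t, iwasawaLift hp (δ t) = γ t := by
  have hpγ : Continuous fun t => p (γ t) := hp.continuous.comp hγ
  let f : C(I, {z : ℂ // z ≠ 0}) :=
    ⟨fun t => ⟨SL2.column (p (γ t)), SL2.column_ne_zero _⟩,
      (SL2.continuous_column.comp hpγ).subtype_mk _⟩
  obtain ⟨l, hl, hl0⟩ := Complex.isCoveringMap_exp.exists_path_lifts f w.1
    (Subtype.ext (by simp [f, h0, SL2.column_iwasawa]))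
  have hl' : ∀ t, Complex.exp (l t) = SL2.column (p (γ t)) := fun t =>
    congrArg Subtype.val (congrFun hl t)
  refine ⟨fun t => (l t, SL2.shear (p (γ t))),
    l.continuous.prodMk (SL2.continuous_shear.comp hpγ), ?_, fun t => ?_⟩
  · ext1
    · exact hl0
    · simp [h0, SL2.shear_iwasawa]
  · have hc : Continuous fun t => iwasawaLift hp (l t, SL2.shear (p (γ t))) :=
      (continuous_iwasawaLift hp).comp
        (l.continuous.prodMk (SL2.continuous_shear.comp hpγ))
    refine congrFun (hp.eq_of_comp_eq hc hγ (funext fun t => ?_) 0 ?_) t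
    · simp [SL2.iwasawa_eq_iff, hl']
    · simp [hl0, h0, SL2.shear_iwasawa]

theorem image_iwasawaLift_mem_nhds {w : ℂ × ℝ} {U : Set (ℂ × ℝ)} (hU : U ∈ 𝓝 w) :
    iwasawaLift hp '' U ∈ 𝓝 (iwasawaLift hp w) := by
  refine image_mem_nhds_of_section hp (continuous_iwasawaLift hp).continuousAt
    (τ := fun Q => (w.1 + Complex.log (SL2.column Q / Complex.exp w.1), SL2.shear Q)) ?_ ?_ ?_ hU
  · refine ContinuousAt.prodMk (continuousAt_const.add (ContinuousAt.clog ?_ ?_))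
      SL2.continuous_shear.continuousAt
    · exact SL2.continuous_column.continuousAt.div_const _
    · simp [SL2.column_iwasawa]
  · simp [SL2.column_iwasawa, SL2.shear_iwasawa]
  · refine Filter.Eventually.of_forall fun Q => ?_
    simp only [proj_iwasawaLift, SL2.iwasawa_eq_iff, and_true]
    rw [Complex.exp_add,
      Complex.exp_log (div_ne_zero (SL2.column_ne_zero Q) (Complex.exp_ne_zero _)),
      mul_div_cancel₀ _ (Complex.exp_ne_zero _)]

/-- The range of `iwasawaLift` contains the path component of the identity. -/
theorem mem_range_iwasawaLift_of_path {γ : I → G} (hγ : Continuous γ) (h0 : γ 0 = 1) :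
    γ 1 ∈ range (iwasawaLift hp) := by
  obtain ⟨δ, -, -, hδ⟩ := exists_path_lift_iwasawaLift hp hγ (w := 0) (by simp [h0])
  exact ⟨δ 1, hδ 1⟩

theorem surjective_iwasawaLift [ConnectedSpace G] : Function.Surjective (iwasawaLift hp) := by
  have hc := continuous_iwasawaLift hp
  let H : Subgroup G :=
    { carrier := range (iwasawaLift hp)
      one_mem' := ⟨0, iwasawaLift_zero hp⟩
      mul_mem' := by
        rintro _ _ ⟨x, rfl⟩ ⟨y, rfl⟩
        have := mem_range_iwasawaLift_of_path hp
          (γ := fun t : I => iwasawaLift hp ((t : ℝ) • x) * iwasawaLift hp ((t : ℝ) • y))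
          (by fun_prop) (by simp)
        simpa using this
      inv_mem' := by
        rintro _ ⟨x, rfl⟩
        have := mem_range_iwasawaLift_of_path hp
          (γ := fun t : I => (iwasawaLift hp ((t : ℝ) • x))⁻¹) (by fun_prop) (by simp)
        simpa using this }
  have hH : (H : Set G) ∈ 𝓝 (1 : G) := by
    have := image_iwasawaLift_mem_nhds hp (w := 0) Filter.univ_mem
    rwa [image_univ, iwasawaLift_zero] at this
  have ho := H.isOpen_of_mem_nhds hH
  have := IsClopen.eq_univ ⟨H.isClosed_of_isOpen ho, ho⟩ ⟨1, H.one_mem⟩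
  exact range_eq_univ.1 this

/-- On a simply connected covering group the complex logarithm of the first column is
well defined. -/
theorem fst_eq_of_iwasawaLift_eq [SimplyConnectedSpace G] {x y : ℂ × ℝ}
    (h : iwasawaLift hp x = iwasawaLift hp y) : x.1 = y.1 := by
  -- The image in `G` of the segment from `x` to `y` is a loop, hence contractible, and so is the
  -- loop of its first columns in `ℂ \ {0}`; the lift of the latter to `ℂ` is a loop.
  let f : C(G, {z : ℂ // z ≠ 0}) :=
    ⟨fun g => ⟨SL2.column (p g), SL2.column_ne_zero _⟩,
      (SL2.continuous_column.comp hp.continuous).subtype_mk _⟩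
  let seg : I → ℂ × ℝ := fun t => x + (t : ℝ) • (y - x)
  have hseg : Continuous seg := by fun_prop
  let γ : Path (iwasawaLift hp x) (iwasawaLift hp x) :=
    { toFun := fun t => iwasawaLift hp (seg t)
      continuous_toFun := (continuous_iwasawaLift hp).comp hseg
      source' := by simp [seg]
      target' := by simp [seg, h] }
  have hom : (γ.map f.continuous).Homotopic ((Path.refl _).map f.continuous) :=
    (SimplyConnectedSpace.paths_homotopic γ (Path.refl _)).map f
  have he := Complex.isCoveringMap_exp.liftPath_apply_one_eq_of_homotopicRel hom x.1
    (Subtype.ext (by simp [f, SL2.column_iwasawa]))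
    (Subtype.ext (by simp [f, SL2.column_iwasawa]))
  have h1 := (Complex.isCoveringMap_exp.eq_liftPath_iff (γ := (γ.map f.continuous).toContinuousMap)
    (e := x.1) (Γ := fun t => (seg t).1)
    (Subtype.ext (by simp [f, SL2.column_iwasawa]))).2
    ⟨by fun_prop, funext fun t => Subtype.ext (by simp [f, γ, SL2.column_iwasawa]), by simp [seg]⟩
  have h2 := (Complex.isCoveringMap_exp.eq_liftPath_iff
    (γ := ((Path.refl (iwasawaLift hp x)).map f.continuous).toContinuousMap)
    (e := x.1) (Γ := fun _ => x.1)
    (Subtype.ext (by simp [f, SL2.column_iwasawa]))).2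
    ⟨by fun_prop, funext fun t => Subtype.ext (by simp [f, SL2.column_iwasawa]), rfl⟩
  have h3 := congrFun h1 1
  have h4 := congrFun h2 1
  have h5 : (seg 1).1 = x.1 := by
    rw [h4]
    exact h3.trans he
  simpa [seg] using h5.symm

/-- If the coordinates are injective, two paths in `G` with common endpoints come from two paths
with common endpoints in the simply connected space `ℂ × ℝ`. -/
theorem simplyConnectedSpace_of_injective_iwasawaLift [ConnectedSpace G]
    (hinj : Function.Injective (iwasawaLift hp)) : SimplyConnectedSpace G := by
  have hc := continuous_iwasawaLift hp
  have hs := surjective_iwasawaLift hp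
  refine simply_connected_iff_paths_homotopic'.2 ⟨hs.pathConnectedSpace hc, fun {g h} γ₁ γ₂ => ?_⟩
  obtain ⟨x, rfl⟩ := hs g
  obtain ⟨y, rfl⟩ := hs h
  have key : ∀ γ : Path (iwasawaLift hp x) (iwasawaLift hp y),
      ∃ δ : Path x y, δ.map hc = γ := by
    intro γ
    obtain ⟨δ, hδc, hδ0, hδ⟩ := exists_path_lift_iwasawaLift hp γ.continuous γ.source
    exact ⟨⟨⟨δ, hδc⟩, hδ0, hinj (by rw [hδ]; exact γ.target)⟩, Path.ext (funext hδ)⟩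
  obtain ⟨δ₁, rfl⟩ := key γ₁
  obtain ⟨δ₂, rfl⟩ := key γ₂
  exact (SimplyConnectedSpace.paths_homotopic δ₁ δ₂).map ⟨_, hc⟩

/-- On a covering group that is not simply connected, some positive rotation is trivial. -/
theorem exists_coverExp_rotation_eq_one [ConnectedSpace G] (h : ¬ SimplyConnectedSpace G) :
    ∃ θ : ℝ, 0 < θ ∧ coverExp hp (θ • (stdA - stdB)) = 1 := by
  have hni : ¬ Function.Injective (iwasawaLift hp) := fun hinj =>
    h (simplyConnectedSpace_of_injective_iwasawaLift hp hinj)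
  obtain ⟨x, y, hxy, hne⟩ : ∃ x y, iwasawaLift hp x = iwasawaLift hp y ∧ x ≠ y := by
    simpa [Function.Injective] using hni
  have hπ : SL2.iwasawa x = SL2.iwasawa y := by simpa using congrArg p hxy
  obtain ⟨h1, h2⟩ := SL2.iwasawa_eq_iff.1 hπ
  rw [SL2.column_iwasawa] at h1
  rw [SL2.shear_iwasawa] at h2
  have hre : x.1.re = y.1.re := by
    have := congrArg norm h1
    simpa [Complex.norm_exp] using this
  have him : x.1.im ≠ y.1.im := fun him => hne (Prod.ext (Complex.ext hre him) h2)
  have hrot : coverExp hp (x.1.im • (stdA - stdB)) = coverExp hp (y.1.im • (stdA - stdB)) := by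
    simpa [iwasawaLift, hre, h2] using hxy
  rcases lt_or_gt_of_ne him with hlt | hlt
  · refine ⟨y.1.im + -x.1.im, by linarith, ?_⟩
    rw [coverExp_add_smul, coverExp_neg_smul, hrot, mul_inv_cancel]
  · refine ⟨x.1.im + -y.1.im, by linarith, ?_⟩
    rw [coverExp_add_smul, coverExp_neg_smul, hrot, mul_inv_cancel]

end IwasawaLift

/-! ### Limits of reachable elements for the standard triple -/

section Standard

open SL2Alg (stdA stdB stdC)

variable {G : Type*} [Group G] [TopologicalSpace G] [IsTopologicalGroup G] {p : G →* SL(2, ℝ)}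

/-- Equivariance of the exponential map under the adjoint action. -/
theorem coverExp_conj (hp : IsCoveringMap p) {X Y : SL2Alg} (D : G)
    (h : Y.1 = (p D).1 * X.1 * (p D⁻¹).1) : coverExp hp Y = D * coverExp hp X * D⁻¹ := by
  have hD : (p D).1 * (p D⁻¹).1 = 1 := by
    rw [← Matrix.SpecialLinearGroup.coe_mul, ← map_mul, mul_inv_cancel, map_one]; rfl
  have hc := continuous_coverExp_smul hp X
  have := eq_coverExp_of_proj hp (X := Y) (f := fun t : ℝ => D * coverExp hp (t • X) * D⁻¹)
    (by fun_prop) (by simp) fun t => by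
      apply Subtype.ext
      rw [SL2Alg.exp_conj (X := t • X) (Y := t • Y) hD]
      · rw [map_mul, map_mul, proj_coverExp]; rfl
      · change t • Y.1 = _ * (t • X.1) * _
        rw [h, Matrix.mul_smul, Matrix.smul_mul]
  simpa using this.symm

/-- Large constant controls during a short time approximate the flow of `b`. -/
theorem coverExp_smul_control_mem_limitReachable {a b : SL2Alg} (hp : IsCoveringMap p) (v : ℝ) :
    coverExp hp (v • b) ∈ limitReachable p a b := by
  refine mem_limitReachable_of_tendsto (K := 1) (c := fun _ => 1) (e := fun _ => 1)
    (d := fun ε => coverExp hp (ε • (a + (v / ε) • b))) (fun _ _ => one_mem_limitReachable hp)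
    (fun ε hε => by simpa using coverExp_mem_reachableWithin hp hε.le _)
    (fun _ _ => one_mem_limitReachable hp) ?_
  have h1 : Filter.Tendsto (fun ε : ℝ => coverExp hp (ε • a + v • b)) (𝓝[>] 0)
      (𝓝 (coverExp hp (v • b))) := by
    have hc : Continuous fun ε : ℝ => coverExp hp (ε • a + v • b) :=
      (continuous_coverExp_smul_add_smul hp a b).comp (f := fun ε : ℝ => (ε, v)) (by fun_prop)
    have := hc.tendsto 0
    simp only [zero_smul, zero_add] at this
    exact this.mono_left nhdsWithin_le_nhds
  refine h1.congr' ?_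
  filter_upwards [self_mem_nhdsWithin] with ε hε
  rw [one_mul, mul_one, smul_add, smul_smul, mul_div_cancel₀ _ (ne_of_gt hε)]

/-- The identity
`(1 (e^s-1)/ε; 0 1) (1 0; ε 1) (1 (e^{-s}-1)/ε; 0 1) = diag(e^s, e^{-s}) (1 0; ε e^s 1)`
of `SL₂(ℝ)` holds in every covering group. -/
theorem coverExp_upper_lower_upper (hp : IsCoveringMap p) {ε : ℝ} (hε : ε ≠ 0) (s : ℝ) :
    coverExp hp (((Real.exp s - 1) / ε) • stdB) * coverExp hp (ε • stdA) *
        coverExp hp (((Real.exp (-s) - 1) / ε) • stdB) =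
      coverExp hp (s • stdC) * coverExp hp ((ε * Real.exp s) • stdA) := by
  have hA := continuous_coverExp_smul hp stdA
  have hB := continuous_coverExp_smul hp stdB
  have hC := continuous_coverExp_smul hp stdC
  refine eq_of_proj_eq_of_apply_zero_eq hp
    (f := fun s => coverExp hp (((Real.exp s - 1) / ε) • stdB) * coverExp hp (ε • stdA) *
        coverExp hp (((Real.exp (-s) - 1) / ε) • stdB))
    (g := fun s => coverExp hp (s • stdC) * coverExp hp ((ε * Real.exp s) • stdA))
    ((((hB.comp (by fun_prop : Continuous fun s : ℝ => (Real.exp s - 1) / ε))).mul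
      continuous_const).mul
      (hB.comp (by fun_prop : Continuous fun s : ℝ => (Real.exp (-s) - 1) / ε)))
    (hC.mul (hA.comp (by fun_prop : Continuous fun s : ℝ => ε * Real.exp s)))
    (fun t => ?_) (by simp) s
  apply Subtype.ext
  simp only [map_mul, proj_coverExp, Matrix.SpecialLinearGroup.coe_mul, SL2Alg.exp_smul_stdA,
    SL2Alg.exp_smul_stdB, SL2Alg.exp_smul_stdC]
  have he : Real.exp t * Real.exp (-t) = 1 := by rw [← Real.exp_add]; simp
  ext i j
  fin_cases i <;> fin_cases j <;> simp <;> field_simp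
  · ring
  · linear_combination he
  · linear_combination -he
  · ring

/-- The element `diag(e^s, e^{-s})` is approached by impulses of the control before and after a
drift of duration `ε → 0`. -/
theorem coverExp_smul_stdC_mem_limitReachable (hp : IsCoveringMap p) (s : ℝ) :
    coverExp hp (s • stdC) ∈ limitReachable p stdA stdB := by
  refine mem_limitReachable_of_tendsto (K := 1)
    (c := fun ε => coverExp hp (((Real.exp s - 1) / ε) • stdB))
    (d := fun ε => coverExp hp (ε • stdA))
    (e := fun ε => coverExp hp (((Real.exp (-s) - 1) / ε) • stdB))
    (fun _ _ => coverExp_smul_control_mem_limitReachable hp _)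
    (fun ε hε => by
      simpa using coverExp_mem_reachableWithin (a := stdA) (b := stdB) hp (le_of_lt hε) 0)
    (fun _ _ => coverExp_smul_control_mem_limitReachable hp _) ?_
  have hc : Continuous fun ε : ℝ =>
      coverExp hp (s • stdC) * coverExp hp ((ε * Real.exp s) • stdA) :=
    continuous_const.mul ((continuous_coverExp_smul hp stdA).comp
      (by fun_prop : Continuous fun ε : ℝ => ε * Real.exp s))
  have h1 := hc.tendsto 0
  simp only [zero_mul, zero_smul, coverExp_zero, mul_one] at h1
  refine (h1.mono_left nhdsWithin_le_nhds).congr' ?_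
  filter_upwards [self_mem_nhdsWithin] with ε hε
  exact (coverExp_upper_lower_upper hp (ne_of_gt hε) s).symm

/-- A rotation is conjugate, by a diagonal element, to the flow of the constant control `-ε⁻²`
during the time `εφ`. -/
theorem coverExp_rotation_mem_limitReachable (hp : IsCoveringMap p) {φ : ℝ} (hφ : 0 ≤ φ) :
    coverExp hp (φ • (stdA - stdB)) ∈ limitReachable p stdA stdB := by
  refine mem_limitReachable_of_tendsto (K := φ)
    (c := fun ε => coverExp hp ((Real.log ε / 2) • stdC))
    (d := fun ε => coverExp hp ((φ * ε) • (stdA + (-(ε ^ 2)⁻¹) • stdB)))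
    (e := fun ε => coverExp hp ((-(Real.log ε / 2)) • stdC))
    (fun _ _ => coverExp_smul_stdC_mem_limitReachable hp _)
    (fun ε hε => coverExp_mem_reachableWithin hp (mul_nonneg hφ (le_of_lt hε)) _)
    (fun _ _ => coverExp_smul_stdC_mem_limitReachable hp _) ?_
  refine tendsto_const_nhds.congr' ?_
  filter_upwards [self_mem_nhdsWithin] with ε hε
  have hε : 0 < ε := hε
  rw [coverExp_neg_smul]
  refine coverExp_conj hp _ ?_
  rw [← coverExp_neg_smul, proj_coverExp, proj_coverExp, SL2Alg.exp_smul_stdC,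
    SL2Alg.exp_smul_stdC]
  have hd : Real.exp (Real.log ε / 2) * Real.exp (Real.log ε / 2) = ε := by
    rw [← Real.exp_add, add_halves, Real.exp_log hε]
  have hd' : Real.exp (-(Real.log ε / 2)) * Real.exp (-(Real.log ε / 2)) = ε⁻¹ := by
    rw [← Real.exp_add, ← neg_add, add_halves, Real.exp_neg, Real.exp_log hε]
  have hA : ((φ • (stdA - stdB) : SL2Alg) : Matrix (Fin 2) (Fin 2) ℝ) = !![0, -φ; φ, 0] := by
    ext i j; fin_cases i <;> fin_cases j <;> simp [stdA, stdB]
  have hB : (((φ * ε) • (stdA + (-(ε ^ 2)⁻¹) • stdB) : SL2Alg) : Matrix (Fin 2) (Fin 2) ℝ) =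
      !![0, -(φ * ε⁻¹); φ * ε, 0] := by
    ext i j; fin_cases i <;> fin_cases j <;> simp [stdA, stdB]
    field_simp
  rw [hA, hB]
  ext i j
  fin_cases i <;> fin_cases j <;> simp
  · linear_combination -(φ * ε⁻¹) * hd - φ * inv_mul_cancel₀ hε.ne'
  · linear_combination -(φ * ε) * hd' - φ * mul_inv_cancel₀ hε.ne'

/-- The closed half-space `θ ≥ 0` consists of limits of elements reachable in small time. -/
theorem iwasawaLift_mem_limitReachable (hp : IsCoveringMap p) {w : ℂ × ℝ} (hw : 0 ≤ w.1.im) :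
    iwasawaLift hp w ∈ limitReachable p stdA stdB :=
  mul_mem_limitReachable (mul_mem_limitReachable (coverExp_rotation_mem_limitReachable hp hw)
    (coverExp_smul_stdC_mem_limitReachable hp _)) (coverExp_smul_control_mem_limitReachable hp _)

end Standard

/-! ### From limits to exact reachability -/

section Exact

open SL2Alg (stdA stdB stdC)

variable {G : Type*} [Group G] [TopologicalSpace G] {p : G →* SL(2, ℝ)}

/-- The motion with controls `0`, `1`, `0` during the times `t₁`, `t₂`, `t₃`. -/
noncomputable def threeStep (hp : IsCoveringMap p) (t : ℝ × ℝ × ℝ) : G :=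
  coverExp hp (t.1 • stdA) * coverExp hp (t.2.1 • (stdA + (1 : ℝ) • stdB)) *
    coverExp hp (t.2.2 • stdA)

theorem proj_threeStep (hp : IsCoveringMap p) (t : ℝ × ℝ × ℝ) : (p (threeStep hp t)).1 =
    !![Real.cosh t.2.1 + Real.sinh t.2.1 * t.2.2, Real.sinh t.2.1;
      t.1 * (Real.cosh t.2.1 + Real.sinh t.2.1 * t.2.2) +
        (Real.sinh t.2.1 + Real.cosh t.2.1 * t.2.2), t.1 * Real.sinh t.2.1 + Real.cosh t.2.1] := by
  simp only [threeStep, map_mul, proj_coverExp, Matrix.SpecialLinearGroup.coe_mul,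
    SL2Alg.exp_smul_stdA, SL2Alg.exp_smul_stdA_add_stdB]
  ext i j
  fin_cases i <;> fin_cases j <;> simp
  ring

variable [IsTopologicalGroup G]

theorem continuous_threeStep (hp : IsCoveringMap p) :
    Continuous (threeStep (G := G) hp) := by
  have h := continuous_coverExp_smul hp
  exact (((h _).comp continuous_fst).mul ((h _).comp (continuous_fst.comp continuous_snd))).mul
    ((h _).comp (continuous_snd.comp continuous_snd))

/-- There are interior points of the reachable sets arbitrarily close to the identity. -/
theorem reachableWithin_mem_nhds_threeStep (hp : IsCoveringMap p) {ε T : ℝ} (hε : 0 < ε)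
    (hT : 3 * ε < T) : reachableWithin p stdA stdB T ∈ 𝓝 (threeStep hp (ε, ε, ε)) := by
  have hU : {t : ℝ × ℝ × ℝ | 0 < t.1 ∧ 0 < t.2.1 ∧ 0 < t.2.2 ∧ t.1 + t.2.1 + t.2.2 < T} ∈
      𝓝 (ε, ε, ε) := by
    have c1 : Continuous fun t : ℝ × ℝ × ℝ => t.2.1 := continuous_fst.comp continuous_snd
    have c2 : Continuous fun t : ℝ × ℝ × ℝ => t.2.2 := continuous_snd.comp continuous_snd
    refine IsOpen.mem_nhds ?_ ⟨hε, hε, hε, by dsimp only; linarith⟩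
    exact (isOpen_lt continuous_const continuous_fst).inter ((isOpen_lt continuous_const c1).inter
      ((isOpen_lt continuous_const c2).inter
        (isOpen_lt ((continuous_fst.add c1).add c2) continuous_const)))
  -- The upper right entry determines `t₂`; the diagonal entries then determine `t₁` and `t₃`.
  have key := image_mem_nhds_of_section hp (continuous_threeStep hp).continuousAt
    (x₀ := (ε, ε, ε))
    (τ := fun Q => ((Q.1 1 1 - Real.cosh (Real.arsinh (Q.1 0 1))) / Q.1 0 1,
      Real.arsinh (Q.1 0 1), (Q.1 0 0 - Real.cosh (Real.arsinh (Q.1 0 1))) / Q.1 0 1))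
    ?_ ?_ ?_ hU
  · refine Filter.mem_of_superset key ?_
    rintro _ ⟨t, ⟨h1, h2, h3, h4⟩, rfl⟩
    refine reachableWithin_mono h4.le (mul_mem_reachableWithin (mul_mem_reachableWithin ?_
      (coverExp_mem_reachableWithin hp h2.le 1)) ?_)
    · simpa using coverExp_mem_reachableWithin (a := stdA) (b := stdB) hp h1.le 0
    · simpa using coverExp_mem_reachableWithin (a := stdA) (b := stdB) hp h3.le 0
  · have h01 : (p (threeStep hp (ε, ε, ε))).1 0 1 ≠ 0 := by
      simpa [proj_threeStep] using hε.ne'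
    have hc := SL2.continuous_entry
    have hs : Continuous fun Q : SL(2, ℝ) => Real.arsinh (Q.1 0 1) :=
      Real.continuous_arsinh.comp (hc 0 1)
    have hch := Real.continuous_cosh.comp hs
    exact (((hc 1 1).sub hch).continuousAt.div (hc 0 1).continuousAt h01).prodMk
      (hs.continuousAt.prodMk (((hc 0 0).sub hch).continuousAt.div (hc 0 1).continuousAt h01))
  · have : Real.sinh ε ≠ 0 := by simpa using hε.ne'
    simp [proj_threeStep, this]
  · have h01 : (p (threeStep hp (ε, ε, ε))).1 0 1 ≠ 0 := by
      simpa [proj_threeStep] using hε.ne'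
    filter_upwards [(SL2.continuous_entry 0 1).continuousAt.eventually_ne h01] with Q hQ
    have hdet := SL2.det_eq_one Q
    have hsq := Real.sq_sqrt (by positivity : 0 ≤ 1 + Q.1 0 1 ^ 2)
    apply Subtype.ext
    rw [proj_threeStep]
    simp only [Real.sinh_arsinh, Real.cosh_arsinh]
    ext i j
    fin_cases i <;> fin_cases j <;> simp <;> field_simp
    · ring
    · linear_combination hdet - hsq
    · ring

/-- Interior points of the set of limits are exactly reachable: near such a point `g` write
`g = h k` with `k` in an open set of reachable elements close to the identity, where `h` can be
moved to a reachable element. -/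
theorem mem_smallTimeReachable_of_mem_nhds (hp : IsCoveringMap p) {g : G}
    (hg : limitReachable p stdA stdB ∈ 𝓝 g) : g ∈ smallTimeReachable p stdA stdB := by
  intro T hT
  have hlim : Filter.Tendsto (fun ε : ℝ => g * (threeStep hp (ε, ε, ε))⁻¹) (𝓝[>] 0) (𝓝 g) := by
    have hc : Continuous fun ε : ℝ => g * (threeStep hp (ε, ε, ε))⁻¹ :=
      continuous_const.mul ((continuous_threeStep hp).comp
        (f := fun ε : ℝ => (ε, ε, ε)) (by fun_prop)).inv
    have := hc.tendsto 0
    simp only [threeStep, zero_smul, coverExp_zero, mul_one, inv_one] at this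
    exact this.mono_left nhdsWithin_le_nhds
  have hsmall : ∀ᶠ ε in 𝓝[>] (0 : ℝ), ε < T / 6 :=
    nhdsWithin_le_nhds (Iio_mem_nhds (by linarith))
  obtain ⟨ε, hεg, hεT, hε⟩ := ((hlim.eventually hg).and
    (hsmall.and self_mem_nhdsWithin)).exists
  have hε : 0 < ε := hε
  set k := threeStep hp (ε, ε, ε) with hk
  have hnhds := reachableWithin_mem_nhds_threeStep hp hε (show 3 * ε < T / 2 by linarith)
  have hcont : ContinuousAt (fun h : G => h⁻¹ * g) (g * k⁻¹) := by fun_prop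
  have hpre : ∀ᶠ h in 𝓝 (g * k⁻¹), h⁻¹ * g ∈ reachableWithin p stdA stdB (T / 2) := by
    refine hcont.eventually ?_
    simpa [hk] using hnhds
  obtain ⟨h, hh1, hh2⟩ := mem_closure_iff_nhds.1 (hεg (T / 2) (by linarith)) _ hpre
  have := mul_mem_reachableWithin hh2 hh1
  rwa [mul_inv_cancel_left, add_halves] at this

theorem iwasawaLift_mem_smallTimeReachable (hp : IsCoveringMap p) {w : ℂ × ℝ}
    (hw : 0 < w.1.im) : iwasawaLift hp w ∈ smallTimeReachable p stdA stdB := by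
  have hU : {w : ℂ × ℝ | 0 < w.1.im} ∈ 𝓝 w :=
    (isOpen_lt continuous_const (Complex.continuous_im.comp continuous_fst)).mem_nhds hw
  refine mem_smallTimeReachable_of_mem_nhds hp
    (Filter.mem_of_superset (image_iwasawaLift_mem_nhds hp hU) ?_)
  rintro _ ⟨z, hz, rfl⟩
  exact iwasawaLift_mem_limitReachable hp (le_of_lt hz)

theorem iwasawaLift_mem_closure (hp : IsCoveringMap p) {w : ℂ × ℝ} (hw : 0 ≤ w.1.im) :
    iwasawaLift hp w ∈ closure (smallTimeReachable p stdA stdB) := by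
  have hc : Continuous fun ε : ℝ => iwasawaLift hp (w.1 + ε * Complex.I, w.2) :=
    (continuous_iwasawaLift hp).comp (by fun_prop)
  have h0 := hc.tendsto 0
  simp only [Complex.ofReal_zero, zero_mul, add_zero, Prod.mk.eta] at h0
  refine mem_closure_of_tendsto (h0.mono_left (nhdsWithin_le_nhds (s := Ioi 0))) ?_
  filter_upwards [self_mem_nhdsWithin] with ε hε
  refine iwasawaLift_mem_smallTimeReachable hp ?_
  have hε : 0 < ε := hε
  simpa using add_pos_of_nonneg_of_pos hw hε

end Exact

/-! ### Rotation along solutions -/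

section Rotation

open SL2Alg (stdA stdB stdC)

theorem hasDerivAt_column_of_control {u : ℝ} {Q : ℝ → SL(2, ℝ)} {t : ℝ}
    (h : HasDerivAt (fun r => (Q r : Matrix (Fin 2) (Fin 2) ℝ))
        ((Q t : Matrix (Fin 2) (Fin 2) ℝ) * (stdA + u • stdB : SL2Alg)) t) :
    HasDerivAt (fun r => SL2.column (Q r))
      ((Q t).1 0 1 + (Q t).1 1 1 * Complex.I) t := by
  rw [Matrix.hasDerivAt_iff_entries] at h
  have hd := (h 0 0).ofReal_comp.add ((h 1 0).ofReal_comp.mul_const Complex.I)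
  refine (hd.congr_deriv ?_).congr_of_eventuallyEq (Filter.Eventually.of_forall fun r => ?_)
  · simp [stdA, stdB, Matrix.mul_apply, Fin.sum_univ_two]
  · simp [SL2.column, Complex.ext_iff]

/-- A continuous logarithm of a differentiable function is differentiable. -/
theorem hasDerivAt_of_exp_eq {l z : ℝ → ℂ} {z' : ℂ} {t : ℝ} (hl : ContinuousAt l t)
    (h : ∀ᶠ r in 𝓝 t, Complex.exp (l r) = z r) (hz : HasDerivAt z z' t) :
    HasDerivAt l (z' / z t) t := by
  have hzt : z t = Complex.exp (l t) := h.self_of_nhds.symm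
  have hne : z t ≠ 0 := hzt ▸ Complex.exp_ne_zero _
  have hlog : HasDerivAt (fun r => l t + Complex.log (z r / z t)) (z' / z t) t := by
    have := ((hz.div_const (z t)).clog_real (by simp [hne])).const_add (l t)
    simpa [hne] using this
  refine hlog.congr_of_eventuallyEq ?_
  have him : ContinuousAt (fun r => (l r - l t).im) t :=
    Complex.continuous_im.continuousAt.comp (hl.sub continuousAt_const)
  have h1 : ∀ᶠ r in 𝓝 t, (l r - l t).im < Real.pi :=
    him.eventually_lt continuousAt_const (by simpa using Real.pi_pos)
  have h2 : ∀ᶠ r in 𝓝 t, -Real.pi < (l r - l t).im :=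
    continuousAt_const.eventually_lt him (by simpa using Real.pi_pos)
  filter_upwards [h, h1, h2] with r hr hr1 hr2
  rw [hzt, ← hr, ← Complex.exp_sub, Complex.log_exp hr2 hr1.le, add_sub_cancel]

variable {G : Type*} [Group G] [TopologicalSpace G] [IsTopologicalGroup G] {p : G →* SL(2, ℝ)}

/-- Along a solution the first column `z` turns counterclockwise: `Im (z' / z) = 1 / |z|²`. -/
theorem IsSolution.exists_iwasawaLift_eq (hp : IsCoveringMap p) {τ : ℝ} (hτ : 0 < τ) {u : ℝ → ℝ}
    {q : ℝ → G} (hq : IsSolution p stdA stdB τ u q) :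
    ∃ w : ℂ × ℝ, 0 ≤ w.1.im ∧ iwasawaLift hp w = q τ := by
  obtain ⟨hqc, hq0, s, hs⟩ := hq
  have hγ : Continuous fun t : I => q (τ * t) :=
    hqc.comp_continuous (by fun_prop) fun t =>
      ⟨mul_nonneg hτ.le t.2.1, mul_le_of_le_one_right hτ.le t.2.2⟩
  obtain ⟨δ, hδc, hδ0, hδ⟩ := exists_path_lift_iwasawaLift hp hγ (w := 0) (by simp [hq0])
  refine ⟨δ 1, ?_, by simp [hδ]⟩
  set l : ℝ → ℂ := fun r => (δ (projIcc 0 1 zero_le_one (r / τ))).1 with hl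
  have hlc : Continuous l := by
    have : Continuous fun r : ℝ => projIcc (0 : ℝ) 1 zero_le_one (r / τ) :=
      continuous_projIcc.comp (by fun_prop)
    exact continuous_fst.comp (hδc.comp this)
  have hexp : ∀ r ∈ Icc 0 τ, Complex.exp (l r) = SL2.column (p (q r)) := by
    intro r hr
    have hmem : r / τ ∈ Icc (0 : ℝ) 1 := ⟨div_nonneg hr.1 hτ.le, (div_le_one hτ).2 hr.2⟩
    rw [hl, ← SL2.column_iwasawa, ← proj_iwasawaLift hp, hδ, projIcc_of_mem _ hmem]
    simp only [mul_div_cancel₀ r hτ.ne']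
  have hl0 : (l 0).im = 0 := by simp [hl, hδ0]
  have hl1 : l τ = (δ 1).1 := by simp [hl, div_self hτ.ne']
  have hderiv : ∀ t ∈ Ioo 0 τ \ (s : Set ℝ),
      HasDerivAt (fun r => (l r).im) (Real.exp (-2 * (l t).re)) t := by
    rintro t ⟨ht, hts⟩
    have hd := hasDerivAt_of_exp_eq hlc.continuousAt
      (Filter.mem_of_superset (Icc_mem_nhds ht.1 ht.2) hexp)
      (hasDerivAt_column_of_control (hs t ht hts))
    have him := (Complex.imCLM.hasFDerivAt.comp_hasDerivAt t hd)
    refine him.congr_deriv ?_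
    have hpos := SL2.sq_add_sq_pos (p (q t))
    have hdet := SL2.det_eq_one (p (q t))
    have hnorm : Real.exp (-2 * (l t).re) =
        ((p (q t)).1 0 0 ^ 2 + (p (q t)).1 1 0 ^ 2)⁻¹ := by
      have h1 : Complex.normSq (Complex.exp (l t)) =
          (p (q t)).1 0 0 ^ 2 + (p (q t)).1 1 0 ^ 2 := by
        rw [hexp t (Ioo_subset_Icc_self ht), Complex.normSq_apply]
        simp only [SL2.column]
        ring
      rw [← h1, Complex.normSq_eq_norm_sq, Complex.norm_exp, ← Real.exp_nat_mul, ← Real.exp_neg]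
      congr 1
      push_cast
      ring
    rw [hnorm]
    simp only [Complex.imCLM_apply, Complex.div_im, Complex.normSq_apply, SL2.column]
    simp only [Complex.add_re, Complex.add_im, Complex.mul_re, Complex.mul_im, Complex.ofReal_re,
      Complex.ofReal_im, Complex.I_re, Complex.I_im]
    rw [← pow_two, ← pow_two]
    field_simp
    linear_combination hdet
  have hcont : Continuous fun t => Real.exp (-2 * (l t).re) := by
    have := Complex.continuous_re.comp hlc
    simp only [Function.comp_def] at this
    fun_prop
  have hint := MeasureTheory.integral_eq_of_hasDerivAt_off_countable_of_le
    (fun r => (l r).im) (fun t => Real.exp (-2 * (l t).re)) hτ.le s.countable_toSet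
    (Complex.continuous_im.comp hlc).continuousOn hderiv (hcont.intervalIntegrable 0 τ)
  have hnn : 0 ≤ ∫ t in (0 : ℝ)..τ, Real.exp (-2 * (l t).re) :=
    intervalIntegral.integral_nonneg hτ.le fun t _ => (Real.exp_pos _).le
  simp only [hint, hl0, hl1, sub_zero] at hnn
  exact hnn

/-! ### Controllability and simple connectedness for the standard triple -/

theorem isSmallTimeControllable_std_iff [ConnectedSpace G] (hp : IsCoveringMap p) :
    IsSmallTimeControllable p stdA stdB ↔ ¬ SimplyConnectedSpace G := by
  constructor
  · intro hc hsc
    -- The rotation by a negative angle would be reached by a solution with nonnegative angle.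
    have hmem : iwasawaLift hp (-Complex.I, 0) ∈ smallTimeReachable p stdA stdB := by
      rw [hc]; trivial
    obtain ⟨τ, hτ, u, q, -, hq, hqτ⟩ := hmem 1 one_pos
    obtain ⟨w, hw, hwq⟩ : ∃ w : ℂ × ℝ, 0 ≤ w.1.im ∧ iwasawaLift hp w = q τ := by
      rcases hτ.1.eq_or_lt with rfl | h
      · exact ⟨0, by simp, by simp [hq.2.1]⟩
      · exact hq.exists_iwasawaLift_eq hp h
    have := fst_eq_of_iwasawaLift_eq hp (hwq.trans hqτ)
    rw [this] at hw
    norm_num at hw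
  · intro hsc
    obtain ⟨θ, hθ, hone⟩ := exists_coverExp_rotation_eq_one hp hsc
    have hmul : ∀ n : ℕ, coverExp hp ((n * θ : ℝ) • (stdA - stdB)) = 1 := by
      intro n
      induction n with
      | zero => simp
      | succ n ih => rw [Nat.cast_succ, add_mul, one_mul, coverExp_add_smul, ih, hone, one_mul]
    refine eq_univ_of_forall fun g => ?_
    obtain ⟨w, rfl⟩ := surjective_iwasawaLift hp g
    -- Full periods of the rotation make the angle positive.
    obtain ⟨n, hn⟩ := exists_nat_gt (-w.1.im / θ)
    have hn' : 0 < n * θ + w.1.im := by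
      rw [div_lt_iff₀ hθ] at hn
      linarith
    have : iwasawaLift hp w = iwasawaLift hp (⟨w.1.re, n * θ + w.1.im⟩, w.2) := by
      simp only [iwasawaLift, coverExp_add_smul, hmul, one_mul]
    rw [this]
    exact iwasawaLift_mem_smallTimeReachable hp hn'

end Rotation

/-! ### Reduction to the standard triple -/

section Conjugation

open SL2Alg (stdA stdB stdC)

/-- Every triple in `sl₂(ℝ)` with the standard brackets is conjugate to the standard one: if
`a e_k ≠ 0`, then `b a e_k`, `a e_k` is a basis of `ℝ²` in which the triple is standard. -/
theorem SL2Alg.exists_conj_std {a b c : SL2Alg} (ha : a ≠ 0) (h_ba : ⁅b, a⁆ = c)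
    (h_ac : ⁅a, c⁆ = (2 : ℝ) • a) (h_bc : ⁅b, c⁆ = (-2 : ℝ) • b) :
    ∃ P P' : Matrix (Fin 2) (Fin 2) ℝ, P * P' = 1 ∧ P' * P = 1 ∧
      stdA.1 = P' * a.1 * P ∧ stdB.1 = P' * b.1 * P ∧ stdC.1 = P' * c.1 * P := by
  obtain ⟨A, hA⟩ : ∃ A, A = a.1 := ⟨_, rfl⟩
  obtain ⟨B, hB⟩ : ∃ B, B = b.1 := ⟨_, rfl⟩
  obtain ⟨C, hC⟩ : ∃ C, C = c.1 := ⟨_, rfl⟩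
  have e1 : B * A - A * B = C := by rw [hA, hB, hC, ← h_ba]; rfl
  have e2 : A * C - C * A = (2 : ℝ) • A := by
    rw [hA, hC]; exact congrArg Subtype.val h_ac
  have e3 : B * C - C * B = (-2 : ℝ) • B := by
    rw [hB, hC]; exact congrArg Subtype.val h_bc
  -- The square of a trace-zero matrix is scalar, so it commutes with `C`.
  have hsq : ∀ M : Matrix (Fin 2) (Fin 2) ℝ, M.trace = 0 → M * M = (-M.det) • 1 := by
    intro M hM
    rw [Matrix.trace_fin_two] at hM
    have h11 : M 1 1 = -M 0 0 := by linarith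
    ext i j
    fin_cases i <;> fin_cases j <;>
      simp [Matrix.mul_apply, Fin.sum_univ_two, Matrix.det_fin_two, h11] <;> ring
  have hAA : A * A = 0 := by
    have h1 : A * A * C = C * (A * A) := by
      rw [hsq A (hA ▸ a.trace_eq_zero)]; simp
    have h2 : (4 : ℝ) • (A * A) = 0 := by
      calc (4 : ℝ) • (A * A) = A * ((2 : ℝ) • A) + ((2 : ℝ) • A) * A := by
            rw [Matrix.mul_smul, Matrix.smul_mul, ← add_smul]; norm_num
        _ = A * A * C - C * (A * A) := by rw [← e2]; noncomm_ring
        _ = 0 := by rw [h1, sub_self]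
    exact (smul_eq_zero.1 h2).resolve_left (by norm_num)
  have hBB : B * B = 0 := by
    have h1 : B * B * C = C * (B * B) := by
      rw [hsq B (hB ▸ b.trace_eq_zero)]; simp
    have h2 : (-4 : ℝ) • (B * B) = 0 := by
      calc (-4 : ℝ) • (B * B) = B * ((-2 : ℝ) • B) + ((-2 : ℝ) • B) * B := by
            rw [Matrix.mul_smul, Matrix.smul_mul, ← add_smul]; norm_num
        _ = B * B * C - C * (B * B) := by rw [← e3]; noncomm_ring
        _ = 0 := by rw [h1, sub_self]
    exact (smul_eq_zero.1 h2).resolve_left (by norm_num)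
  have hABA : A * B * A = A := by
    have : (2 : ℝ) • (A * B * A) = (2 : ℝ) • A := by
      rw [← e2, ← e1]
      calc (2 : ℝ) • (A * B * A) = A * B * A + A * B * A - A * A * B - B * (A * A) := by
            rw [hAA, two_smul]; simp
        _ = _ := by noncomm_ring
    exact smul_right_injective _ two_ne_zero this
  obtain ⟨i₀, k, hk⟩ : ∃ i k, A i k ≠ 0 := by
    by_contra! h
    exact ha (Subtype.ext (hA ▸ Matrix.ext h))
  set P : Matrix (Fin 2) (Fin 2) ℝ := !![(B * A) 0 k, A 0 k; (B * A) 1 k, A 1 k] with hP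
  have hP0 : ∀ i, P i 0 = (B * A) i k := by intro i; fin_cases i <;> rfl
  have hP1 : ∀ i, P i 1 = A i k := by intro i; fin_cases i <;> rfl
  have hcol : ∀ (M N : Matrix (Fin 2) (Fin 2) ℝ) (i : Fin 2),
      M i 0 * N 0 k + M i 1 * N 1 k = (M * N) i k := fun M N i => by
    rw [Matrix.mul_apply, Fin.sum_univ_two]
  have hAP : A * P = P * stdA.1 := by
    ext i j
    fin_cases j
    · simp [Matrix.mul_apply, Fin.sum_univ_two, stdA, hP1]
      rw [hP0, hP0, hcol, ← mul_assoc, hABA]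
    · simp [Matrix.mul_apply, Fin.sum_univ_two, stdA, hP1]
      rw [hcol, hAA]; rfl
  have hBP : B * P = P * stdB.1 := by
    ext i j
    fin_cases j
    · simp [Matrix.mul_apply, Fin.sum_univ_two, stdB]
      rw [hP0, hP0, hcol, ← mul_assoc, hBB, zero_mul]; rfl
    · simp [Matrix.mul_apply, Fin.sum_univ_two, stdB, hP1]
      rw [hcol, hP0]
  have hdet : P.det ≠ 0 := by
    intro h0
    obtain ⟨x, hx, hPx⟩ := Matrix.exists_mulVec_eq_zero_iff.2 h0
    have h1 : (P * stdA.1).mulVec x = 0 := by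
      rw [← hAP, ← Matrix.mulVec_mulVec, hPx, Matrix.mulVec_zero]
    have hx0 : x 0 = 0 := by
      have := congrFun h1 i₀
      simpa [Matrix.mulVec, dotProduct, Fin.sum_univ_two, Matrix.mul_apply, stdA, hP1, hk]
        using this
    have hx1 : x 1 = 0 := by
      have := congrFun hPx i₀
      simpa [Matrix.mulVec, dotProduct, Fin.sum_univ_two, hP1, hk, hx0] using this
    exact hx (funext fun i => by fin_cases i <;> assumption)
  have hu : IsUnit P.det := isUnit_iff_ne_zero.2 hdet
  have hstd : stdC.1 = stdB.1 * stdA.1 - stdA.1 * stdB.1 := by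
    ext i j; fin_cases i <;> fin_cases j <;> simp [stdA, stdB, stdC]
  have hCP : C * P = P * stdC.1 := by
    rw [← e1, hstd, sub_mul, mul_sub, mul_assoc, mul_assoc, hAP, hBP, ← mul_assoc, ← mul_assoc,
      hAP, hBP, mul_assoc, mul_assoc]
  have hconj : ∀ M N : Matrix (Fin 2) (Fin 2) ℝ, M * P = P * N → N = P⁻¹ * M * P := by
    intro M N h
    rw [mul_assoc, h, ← mul_assoc, Matrix.nonsing_inv_mul _ hu, one_mul]
  exact ⟨P, P⁻¹, Matrix.mul_nonsing_inv _ hu, Matrix.nonsing_inv_mul _ hu,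
    hA ▸ hconj _ _ hAP, hB ▸ hconj _ _ hBP, hC ▸ hconj _ _ hCP⟩

namespace SL2

/-- Conjugation `Q ↦ L Q R` by an invertible real matrix `L` with inverse `R`. -/
def conj (L R : Matrix (Fin 2) (Fin 2) ℝ) (hLR : L * R = 1) (hRL : R * L = 1) :
    SL(2, ℝ) ≃* SL(2, ℝ) where
  toFun Q := ⟨L * Q.1 * R, by
    rw [Matrix.det_mul, Matrix.det_mul, Q.2, mul_one, ← Matrix.det_mul, hLR, Matrix.det_one]⟩
  invFun Q := ⟨R * Q.1 * L, by
    rw [Matrix.det_mul, Matrix.det_mul, Q.2, mul_one, ← Matrix.det_mul, hRL, Matrix.det_one]⟩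
  left_inv Q := Subtype.ext (by
    change R * (L * Q.1 * R) * L = Q.1
    rw [mul_assoc, mul_assoc, mul_assoc, hRL, mul_one, ← mul_assoc, hRL, one_mul])
  right_inv Q := Subtype.ext (by
    change L * (R * Q.1 * L) * R = Q.1
    rw [mul_assoc, mul_assoc, mul_assoc, hLR, mul_one, ← mul_assoc, hLR, one_mul])
  map_mul' Q Q' := Subtype.ext (by
    change L * (Q.1 * Q'.1) * R = L * Q.1 * R * (L * Q'.1 * R)
    calc L * (Q.1 * Q'.1) * R = L * Q.1 * 1 * Q'.1 * R := by simp only [mul_one, mul_assoc]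
      _ = L * Q.1 * R * (L * Q'.1 * R) := by rw [← hRL]; simp only [mul_assoc])

/-- Conjugation by `L` as a self-homeomorphism of `SL₂(ℝ)`. -/
def conjHomeomorph (L R : Matrix (Fin 2) (Fin 2) ℝ) (hLR : L * R = 1) (hRL : R * L = 1) :
    SL(2, ℝ) ≃ₜ SL(2, ℝ) where
  toEquiv := (conj L R hLR hRL).toEquiv
  continuous_toFun := Continuous.subtype_mk
    ((continuous_const.mul continuous_subtype_val).mul continuous_const) _
  continuous_invFun := Continuous.subtype_mk
    ((continuous_const.mul continuous_subtype_val).mul continuous_const) _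

end SL2

variable {G : Type*} [Group G] [TopologicalSpace G] {p p' : G →* SL(2, ℝ)}
  {L R : Matrix (Fin 2) (Fin 2) ℝ} {a b a' b' : SL2Alg}

theorem IsSolution.conj (hRL : R * L = 1) (hp' : ∀ g, (p' g).1 = L * (p g).1 * R)
    (ha : a'.1 = L * a.1 * R) (hb : b'.1 = L * b.1 * R) {τ : ℝ} {u : ℝ → ℝ} {q : ℝ → G}
    (h : IsSolution p a b τ u q) : IsSolution p' a' b' τ u q := by
  obtain ⟨hc, h0, s, hs⟩ := h
  refine ⟨hc, h0, s, fun t ht hts => ?_⟩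
  have hd := hs t ht hts
  rw [Matrix.hasDerivAt_iff_entries] at hd ⊢
  intro i j
  have hent : ∀ M : Matrix (Fin 2) (Fin 2) ℝ, (L * M * R) i j =
      (L i 0 * M 0 0 + L i 1 * M 1 0) * R 0 j + (L i 0 * M 0 1 + L i 1 * M 1 1) * R 1 j := by
    intro M; simp [Matrix.mul_apply, Fin.sum_univ_two]
  have hder : (p' (q t)).1 * (a' + u t • b' : SL2Alg).1 =
      L * ((p (q t)).1 * (a + u t • b : SL2Alg).1) * R := by
    have h1 : (a' + u t • b' : SL2Alg).1 = L * (a + u t • b : SL2Alg).1 * R := by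
      change a'.1 + u t • b'.1 = L * (a.1 + u t • b.1) * R
      rw [ha, hb, mul_add, add_mul, Matrix.mul_smul, Matrix.smul_mul]
    rw [h1, hp']
    calc L * (p (q t)).1 * R * (L * (a + u t • b : SL2Alg).1 * R)
        = L * (p (q t)).1 * (R * L) * (a + u t • b : SL2Alg).1 * R := by simp only [mul_assoc]
      _ = _ := by rw [hRL, mul_one]; simp only [mul_assoc]
  have hfun : (fun r => (p' (q r)).1 i j) = fun r => (L * (p (q r)).1 * R) i j := by
    funext r; rw [hp']
  change HasDerivAt (fun r => (p' (q r)).1 i j) (((p' (q t)).1 * (a' + u t • b' : SL2Alg).1) i j) t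
  rw [hder, hfun]
  simp only [hent]
  exact ((((hd 0 0).const_mul _).add ((hd 1 0).const_mul _)).mul_const _).add
    ((((hd 0 1).const_mul _).add ((hd 1 1).const_mul _)).mul_const _)

theorem smallTimeReachable_subset_of_conj (hRL : R * L = 1)
    (hp' : ∀ g, (p' g).1 = L * (p g).1 * R)
    (ha : a'.1 = L * a.1 * R) (hb : b'.1 = L * b.1 * R) :
    smallTimeReachable p a b ⊆ smallTimeReachable p' a' b' := by
  intro g hg T hT
  obtain ⟨τ, hτ, u, q, hu, hq, h⟩ := hg T hT
  exact ⟨τ, hτ, u, q, hu, hq.conj hRL hp' ha hb, h⟩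

theorem smallTimeReachable_eq_of_conj (hLR : L * R = 1) (hRL : R * L = 1)
    (hp' : ∀ g, (p' g).1 = L * (p g).1 * R)
    (ha : a'.1 = L * a.1 * R) (hb : b'.1 = L * b.1 * R) :
    smallTimeReachable p' a' b' = smallTimeReachable p a b := by
  have hinv : ∀ {M N : Matrix (Fin 2) (Fin 2) ℝ}, N = L * M * R → M = R * N * L := by
    rintro M _ rfl
    rw [mul_assoc, mul_assoc, mul_assoc, hRL, mul_one, ← mul_assoc, hRL, one_mul]
  exact Subset.antisymm
    (smallTimeReachable_subset_of_conj hLR (fun g => hinv (hp' g)) (hinv ha) (hinv hb))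
    (smallTimeReachable_subset_of_conj hRL hp' ha hb)

/-- The exponential map of `G` is intrinsic: it does not change when the projection and the
identification of the Lie algebra are conjugated simultaneously. -/
theorem coverExp_eq_of_conj (hp : IsCoveringMap p) (hpc : IsCoveringMap p') (hLR : L * R = 1)
    (hp' : ∀ g, (p' g).1 = L * (p g).1 * R) {X X' : SL2Alg} (hX : X'.1 = L * X.1 * R) :
    coverExp hp X = coverExp hpc X' := by
  have := eq_coverExp_of_proj hpc (X := X') (f := fun t : ℝ => coverExp hp (t • X))
    (continuous_coverExp_smul hp X) (by simp) fun t => by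
      apply Subtype.ext
      rw [hp', proj_coverExp, SL2Alg.exp_conj (X := t • X) (Y := t • X') hLR]
      change t • X'.1 = L * (t • X.1) * R
      rw [hX, Matrix.mul_smul, Matrix.smul_mul]
  simpa using this

end Conjugation

/-! ### Transfer to an arbitrary triple -/

theorem mainTheorem2
    (a b c : SL2Alg) (h_basis : LinearIndependent ℝ ![a, b, c])
    (h_ba : ⁅b, a⁆ = c) (h_ac : ⁅a, c⁆ = (2 : ℝ) • a) (h_bc : ⁅b, c⁆ = (-2 : ℝ) • b)
    {G : Type*} [Group G] [TopologicalSpace G] [IsTopologicalGroup G] [ConnectedSpace G]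
    (p : G →* SL(2, ℝ)) (hp : IsCoveringMap p) :
    IsGoodLieBracket hp a b b ∧
    IsGoodLieBracket hp a b c ∧
    (∀ t : ℝ, 0 ≤ t → IsSmallTimeApproxReachable p a b (coverExp hp (t • (a - b)))) ∧
    (IsSmallTimeControllable p a b ↔ ¬ SimplyConnectedSpace G) := by
  have ha0 : a ≠ 0 := h_basis.ne_zero 0
  obtain ⟨P, P', hPP', hP'P, ha, hb, hc⟩ :=
    SL2Alg.exists_conj_std ha0 h_ba h_ac h_bc
  let p' : G →* SL(2, ℝ) := (SL2.conj P' P hP'P hPP').toMonoidHom.comp p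
  have hp' : ∀ g, (p' g).1 = P' * (p g).1 * P := fun _ => rfl
  have hpc : IsCoveringMap p' := hp.homeomorph_comp (SL2.conjHomeomorph P' P hP'P hPP')
  have hreach := smallTimeReachable_eq_of_conj hP'P hPP' hp' ha hb
  have hexp : ∀ {X Y : SL2Alg}, Y.1 = P' * X.1 * P → ∀ t : ℝ,
      coverExp hp (t • X) = coverExp hpc (t • Y) := by
    intro X Y h t
    refine coverExp_eq_of_conj hp hpc hP'P hp' ?_
    change t • Y.1 = P' * (t • X.1) * P
    rw [h, Matrix.mul_smul, Matrix.smul_mul]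
  have hab : (SL2Alg.stdA - SL2Alg.stdB).1 = P' * (a - b).1 * P := by
    change SL2Alg.stdA.1 - SL2Alg.stdB.1 = P' * (a.1 - b.1) * P
    rw [ha, hb, mul_sub, sub_mul]
  refine ⟨fun v => ?_, fun v => ?_, fun t ht => ?_, ?_⟩
  · rw [IsSmallTimeApproxReachable, ← hreach, hexp hb]
    simpa [iwasawaLift] using iwasawaLift_mem_closure hpc (w := (0, v)) (by simp)
  · rw [IsSmallTimeApproxReachable, ← hreach, hexp hc]
    simpa [iwasawaLift] using iwasawaLift_mem_closure hpc (w := (v, 0)) (by simp)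
  · rw [IsSmallTimeApproxReachable, ← hreach, hexp hab]
    simpa [iwasawaLift] using iwasawaLift_mem_closure hpc (w := (t * Complex.I, 0)) (by simpa)
  · rw [IsSmallTimeControllable, ← hreach]
    exact isSmallTimeControllable_std_iff hpc
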